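/- **Theorem.** Let $0<p<1$, $q=1-p$, and $H=-p\ln p-q\ln q$. For a finite binary string $\alpha=\alpha_1\cdots\alpha_n\in\bigcup_{k\ge0}\{0,1\}^k$ put $P(\alpha)=\prod_{i=1}^n p^{\alpha_i}q^{1-\alpha_i}$ (so $P=1$ for the empty string). Let $f$ be a non-negative real function on $(0,\infty)$ that is continuous at almost every point and satisfies, for some constant $C$, $f(x)\le Cx^2$ for $0<x<1$ and $f(x)\le C$ for $1<x<\infty$. For $\lambda>0$ let $F(\lambda)=\sum_{\alpha}f(\lambda P(\alpha))$, the sum being over all finite binary strings $\alpha$, and let $g(t)=e^tf(e^{-t})$ for $t\in\mathbb R$. Then the sum $F(\lambda)$ converges for every $\lambda>0$, the function $g$ is integrable on $\mathbb R$, the function $f(x)x^{-2}$ is integrable on $(0,\infty)$, and the following hold. (i) If $\ln p/\ln q$ is irrational, then, as $\lambda\to\infty$, $$\frac{F(\lambda)}{\lambda}\to\frac1H\int_{-\infty}^{\infty}g(t)\,dt=\frac1H\int_0^\infty f(x)x^{-2}\,dx.$$ (ii) If $\ln p/\ln q$ is rational, then there is a largest positive real number $d=\gcd(\ln p,\ln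 q)$ such that $\ln p$ and $\ln q$ are both integer multiples of $d$, and, as $\lambda\to\infty$, $$\frac{F(\lambda)}{\lambda}=\frac1H\psi(\ln\lambda)+o(1),$$ where $\psi:\mathbb R\to\mathbb R$ is a bounded $d$-periodic function, integrable over a period, with the (formal) Fourier series $\psi(t)\sim\sum_{m\in\mathbb Z}\widehat\psi(m)e^{2\pi i mt/d}$; that is, its Fourier coefficients $\frac1d\int_0^d\psi(t)e^{-2\pi i mt/d}\,dt$ are $$\widehat\psi(m)=\widehat g(-2\pi m/d)=\int_{-\infty}^{\infty}e^{2\pi i mt/d}g(t)\,dt=\int_0^\infty f(x)x^{-2-2\pi i m/d}\,dx,\qquad m\in\mathbb Z,$$ where $\widehat g(s)=\int_{-\infty}^\infty e^{-ist}g(t)\,dt$. Furthermore, for every $t\in\mathbb R$, $$\psi(t)=d\sum_{k=-\infty}^{\infty}g(kd-t),$$ the series being convergent. If $f$ is continuous on $(0,\infty)$, then $\psi$ is continuous. -/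

import Mathlib

open Filter Topology MeasureTheory Set

noncomputable section

namespace TrieRenewal

/-- The probability of a letter of the alphabet `{0, 1}` (`true` is `1`, `false` is `0`):
`P(1) = p` and `P(0) = q = 1 - p`. -/
def letterProb (p : ℝ) (a : Bool) : ℝ := if a then p else 1 - p

/-- `P(α) = ∏ P(αᵢ)`, the probability that an i.i.d. `Be(p)` string begins with the finite
string `α`; the empty string has `P = 1`. -/
def stringProb (p : ℝ) (α : List Bool) : ℝ := (α.map (letterProb p)).prod

/-- The entropy `H = -p ln p - q ln q` of a letter, with `q = 1 - p`. -/
def entropy (p : ℝ) : ℝ := -p * Real.log p - (1 - p) * Real.log (1 - p)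

/-- `F(l) = ∑ f(l P(α))`, over all finite binary strings `α`. -/
def stringSum (p : ℝ) (f : ℝ → ℝ) (l : ℝ) : ℝ := ∑' α : List Bool, f (l * stringProb p α)

/-- `g(t) = e^t f(e^{-t})`. -/
def gFun (f : ℝ → ℝ) (t : ℝ) : ℝ := Real.exp t * f (Real.exp (-t))

/-- The positive reals of which both `x` and `y` are integer multiples. -/
def commonDivisors (x y : ℝ) : Set ℝ :=
  {δ | 0 < δ ∧ (∃ m : ℤ, x = m * δ) ∧ ∃ n : ℤ, y = n * δ}

/-- `gcd(x, y)`: the largest positive real of which both `x` and `y` are integer multiples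
(a default value if there is none). -/
def realGcd (x y : ℝ) : ℝ := sSup (commonDivisors x y)

/-- The span `d = gcd(ln p, ln q)`, with `q = 1 - p`. -/
def span (p : ℝ) : ℝ := realGcd (Real.log p) (Real.log (1 - p))

/-- `ĝ(s) = ∫ e^{-ist} g(t) dt` over the real line. -/
def fourierHat (g : ℝ → ℝ) (s : ℝ) : ℂ :=
  ∫ t : ℝ, Complex.exp (-(Complex.I * s * t)) * (g t : ℂ)

/-- The function `ψ`, considered with period `T > 0`, has the (formal) Fourier series
`∑ c(m) e^{2πimt/T}`: it is integrable over a period and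
`c(m) = (1/T) ∫_0^T e^{-2πimt/T} ψ(t) dt` for every integer `m`. -/
def HasFourierSeries (T : ℝ) (ψ : ℝ → ℝ) (c : ℤ → ℂ) : Prop :=
  IntervalIntegrable ψ volume 0 T ∧
    ∃ hT : 0 < T, ∀ m : ℤ, fourierCoeffOn hT (fun t => (ψ t : ℂ)) m = c m

end TrieRenewal

end

open TrieRenewal

namespace TrieRenewal

/-! Put `a = -ln p`, `b = -ln q` and `h(t) = ∑ P(α) g(-ln P(α) - t)`. Then `F(l)/l = h(ln l)`, and
splitting off the first letter gives the renewal equation `h(t) = g(-t) + p h(t - a) + q h(t - b)`.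
The growth conditions on `f` say that `g ≤ C e^{-|t|}`, which makes `h` bounded and makes it vanish
at `-∞` (`exists_renewalSum_wt_le`, `exists_renewalSum_wt_le_exp`). The theorem is a renewal theorem
for `h`, proved by a maximum principle and a conserved window.

Maximum principle (`exists_filter_tendsto_shift`): as `t → ∞`, `h(t)` is asymptotically an average
of `h(t - a)` and `h(t - b)`. Wherever `h` is close to its upper limit `M`, so are both terms, and
hence all translates of `h` by the semigroup generated by `a` and `b`.

Conserved window: averages of `h` over windows of lengths `a` and `b`, weighted by `p` and `q`,
change only through `g`, so they are known exactly. If `a = id` and `b = jd` with `i, j` coprime,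
the windows are sums along a lattice and equal `∑_{k ≥ 0} g(kd - t)` (`hasSum_window`). The
semigroup contains all large multiples of `d`; applied to `h` minus the periodic candidate, the
principle gives `M = 0`, and likewise for the negative. If `a/b` is irrational, the windows are
integrals with limit `∫ g` (`tendsto_renewal_average`). The semigroup is asymptotically dense, so
for uniformly continuous `h` a whole window is close to `M` and `M H = ∫ g`. An almost everywhere
continuous `g` is then approximated from below by Lipschitz envelopes times the weight, and from
above by treating `C e^{-|t|} - g` in the same way. -/

/-- The two-sided exponential weight `e^{-|x|}`. -/
noncomputable def wt (x : ℝ) : ℝ := Real.exp (-|x|)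

/-- The renewal sum `∑ P(α) g(-ln P(α) - t)`, over all finite binary strings `α`. -/
noncomputable def renewalSum (p : ℝ) (g : ℝ → ℝ) (t : ℝ) : ℝ :=
  ∑' α : List Bool, stringProb p α * g (-Real.log (stringProb p α) - t)

/-! ### Estimates for the weight `e^{-|x|}` -/

lemma wt_pos (x : ℝ) : 0 < wt x := Real.exp_pos _

lemma wt_zero : wt 0 = 1 := by simp [wt]

lemma nonneg_of_abs_le_wt {g : ℝ → ℝ} {C : ℝ} (hg : ∀ x, |g x| ≤ C * wt x) : 0 ≤ C := by
  have := (abs_nonneg _).trans (hg 0)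
  rwa [wt_zero, mul_one] at this

lemma wt_le_one (x : ℝ) : wt x ≤ 1 := by
  simp [wt]

lemma wt_neg (x : ℝ) : wt (-x) = wt x := by simp [wt]

lemma wt_le_exp (x : ℝ) : wt x ≤ Real.exp x :=
  Real.exp_le_exp.2 (by linarith [neg_abs_le x])

lemma wt_le_exp_neg (x : ℝ) : wt x ≤ Real.exp (-x) :=
  Real.exp_le_exp.2 (by linarith [le_abs_self x])

/-- The logarithm of the weight is 1-Lipschitz. -/
lemma wt_le_exp_mul (x y : ℝ) : wt x ≤ Real.exp |x - y| * wt y := by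
  rw [wt, wt, ← Real.exp_add]
  refine Real.exp_le_exp.2 ?_
  have := abs_sub_abs_le_abs_sub y x
  rw [abs_sub_comm] at this
  linarith

lemma abs_wt_sub_le (x y : ℝ) : |wt x - wt y| ≤ (Real.exp |x - y| - 1) * wt x := by
  have h1 := wt_le_exp_mul x y
  have h2 := wt_le_exp_mul y x
  rw [abs_sub_comm y x] at h2
  have h3 : 1 ≤ Real.exp |x - y| := Real.one_le_exp (abs_nonneg _)
  rw [abs_le]
  constructor
  · linarith
  · have : wt x - wt y ≤ (Real.exp |x - y| - 1) * wt y := by linarith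
    rcases le_total (wt y) (wt x) with h | h
    · exact this.trans (by gcongr)
    · nlinarith [wt_pos x]

lemma continuous_wt : Continuous wt := by
  unfold wt; fun_prop

lemma integrable_wt : Integrable wt := by
  rw [← integrableOn_univ, ← Iic_union_Ioi (a := (0 : ℝ))]
  refine IntegrableOn.union ?_ ?_
  · refine (integrableOn_exp_Iic 0).congr_fun (fun x hx => ?_) measurableSet_Iic
    simp [wt, abs_of_nonpos (mem_Iic.1 hx)]
  · refine (integrableOn_exp_neg_Ioi 0).congr_fun (fun x hx => ?_) measurableSet_Ioi
    simp [wt, abs_of_pos (mem_Ioi.1 hx)]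

/-! ### String probabilities, the renewal equation and boundedness -/

section Strings

variable {p : ℝ}

lemma stringProb_nil : stringProb p [] = 1 := by simp [stringProb]

lemma stringProb_cons (a : Bool) (α : List Bool) :
    stringProb p (a :: α) = letterProb p a * stringProb p α := by
  simp [stringProb]

lemma stringProb_pos (hp0 : 0 < p) (hp1 : p < 1) (α : List Bool) : 0 < stringProb p α := by
  induction α with
  | nil => simp [stringProb_nil]
  | cons a α ih =>
    rw [stringProb_cons]
    refine mul_pos ?_ ih
    cases a <;> simp [letterProb] <;> linarith

lemma stringProb_ofFn (n : ℕ) (v : Fin n → Bool) :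
    stringProb p (List.ofFn v) = ∏ i, letterProb p (v i) := by
  simp [stringProb, List.map_ofFn, List.prod_ofFn]

/-- The strings of length `n` contribute `(p² + q²)^n`, a geometric series of ratio below 1. -/
lemma summable_stringProb_sq (hp0 : 0 < p) (hp1 : p < 1) :
    Summable fun α : List Bool => stringProb p α ^ 2 := by
  rw [← List.equivSigmaTuple.symm.summable_iff]
  refine (summable_sigma_of_nonneg fun _ => sq_nonneg _).2 ⟨fun n => Summable.of_finite, ?_⟩
  have h : ∀ n : ℕ, ∑' v : Fin n → Bool,
      ((fun α : List Bool => stringProb p α ^ 2) ∘ List.equivSigmaTuple.symm) ⟨n, v⟩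
        = (p ^ 2 + (1 - p) ^ 2) ^ n := by
    intro n
    rw [tsum_fintype]
    have h1 : ∀ v : Fin n → Bool,
        ((fun α : List Bool => stringProb p α ^ 2) ∘ List.equivSigmaTuple.symm) ⟨n, v⟩
          = ∏ i, letterProb p (v i) ^ 2 := by
      intro v
      simp only [Function.comp, List.equivSigmaTuple, Equiv.coe_fn_symm_mk]
      rw [stringProb_ofFn, Finset.prod_pow]
    rw [Finset.sum_congr rfl fun v _ => h1 v,
      ← Fintype.sum_pow (fun a : Bool => letterProb p a ^ 2)]
    simp [letterProb]
  refine Summable.congr ?_ fun n => (h n).symm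
  exact summable_geometric_of_lt_one (by positivity) (by nlinarith)

/-- A finite string is empty or a letter followed by a finite string. -/
def listBoolEquiv : Unit ⊕ (List Bool ⊕ List Bool) ≃ List Bool where
  toFun
    | Sum.inl _ => []
    | Sum.inr (Sum.inl α) => true :: α
    | Sum.inr (Sum.inr α) => false :: α
  invFun
    | [] => Sum.inl ()
    | true :: α => Sum.inr (Sum.inl α)
    | false :: α => Sum.inr (Sum.inr α)
  left_inv := by rintro (_ | _ | _) <;> rfl
  right_inv := by rintro (_ | ⟨_ | _, _⟩) <;> rfl

lemma tsum_list_bool {u : List Bool → ℝ} (hu : Summable u) :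
    ∑' α, u α = u [] + (∑' α, u (true :: α) + ∑' α, u (false :: α)) := by
  have h1 : Summable fun α => u (true :: α) :=
    hu.comp_injective (i := fun α => true :: α) List.cons_injective
  have h2 : Summable fun α => u (false :: α) :=
    hu.comp_injective (i := fun α => false :: α) List.cons_injective
  rw [← listBoolEquiv.tsum_eq]
  rw [Summable.tsum_sum]
  · simp [listBoolEquiv]
    rw [Summable.tsum_sum]
    · exact h1
    · exact h2
  · exact Summable.of_finite
  · exact (listBoolEquiv.summable_iff.2 hu).comp_injective Sum.inr_injective

lemma stringProb_mul_exp (hp0 : 0 < p) (hp1 : p < 1) (α : List Bool) (t : ℝ) :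
    stringProb p α * Real.exp (-(-Real.log (stringProb p α) - t))
      = Real.exp t * stringProb p α ^ 2 := by
  have : -(-Real.log (stringProb p α) - t) = t + Real.log (stringProb p α) := by ring
  rw [this, Real.exp_add, Real.exp_log (stringProb_pos hp0 hp1 α)]
  ring

lemma stringProb_mul_wt_le (hp0 : 0 < p) (hp1 : p < 1) (α : List Bool) (t : ℝ) :
    stringProb p α * wt (-Real.log (stringProb p α) - t) ≤ Real.exp t * stringProb p α ^ 2 := by
  rw [← stringProb_mul_exp hp0 hp1]
  exact mul_le_mul_of_nonneg_left (wt_le_exp_neg _) (stringProb_pos hp0 hp1 α).le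

lemma summable_wt_renewal (hp0 : 0 < p) (hp1 : p < 1) (t : ℝ) :
    Summable fun α : List Bool => stringProb p α * wt (-Real.log (stringProb p α) - t) :=
  Summable.of_nonneg_of_le
    (fun α => mul_nonneg (stringProb_pos hp0 hp1 α).le (wt_pos _).le)
    (fun α => stringProb_mul_wt_le hp0 hp1 α t) ((summable_stringProb_sq hp0 hp1).mul_left _)

lemma abs_stringProb_mul_le (hp0 : 0 < p) (hp1 : p < 1) {g : ℝ → ℝ} {C : ℝ}
    (hg : ∀ x, |g x| ≤ C * wt x) (t : ℝ) (α : List Bool) :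
    |stringProb p α * g (-Real.log (stringProb p α) - t)|
      ≤ C * (stringProb p α * wt (-Real.log (stringProb p α) - t)) := by
  have h := stringProb_pos hp0 hp1 α
  rw [abs_mul, abs_of_pos h, mul_left_comm]
  exact mul_le_mul_of_nonneg_left (hg _) h.le

lemma summable_renewal (hp0 : 0 < p) (hp1 : p < 1) {g : ℝ → ℝ} {C : ℝ}
    (hg : ∀ x, |g x| ≤ C * wt x) (t : ℝ) :
    Summable fun α : List Bool => stringProb p α * g (-Real.log (stringProb p α) - t) :=
  Summable.of_norm_bounded ((summable_wt_renewal hp0 hp1 t).mul_left C)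
    (abs_stringProb_mul_le hp0 hp1 hg t)

lemma abs_renewalSum_le (hp0 : 0 < p) (hp1 : p < 1) {g : ℝ → ℝ} {C : ℝ}
    (hg : ∀ x, |g x| ≤ C * wt x) (t : ℝ) :
    |renewalSum p g t| ≤ C * renewalSum p wt t := by
  rw [renewalSum, renewalSum, ← tsum_mul_left, ← Real.norm_eq_abs]
  exact tsum_of_norm_bounded ((summable_wt_renewal hp0 hp1 t).mul_left C).hasSum
    (abs_stringProb_mul_le hp0 hp1 hg t)

/-- The renewal equation. -/
lemma renewalSum_eq (hp0 : 0 < p) (hp1 : p < 1) {g : ℝ → ℝ} {C : ℝ}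
    (hg : ∀ x, |g x| ≤ C * wt x) (t : ℝ) :
    renewalSum p g t = g (-t) + (p * renewalSum p g (t - -Real.log p)
      + (1 - p) * renewalSum p g (t - -Real.log (1 - p))) := by
  have hq : 0 < 1 - p := by linarith
  rw [renewalSum, tsum_list_bool (summable_renewal hp0 hp1 hg t), renewalSum, renewalSum,
    ← tsum_mul_left, ← tsum_mul_left]
  congr 1
  · simp [stringProb_nil]
  congr 1
  · refine tsum_congr fun α => ?_
    have h := stringProb_pos hp0 hp1 α
    rw [stringProb_cons, letterProb, if_pos rfl, Real.log_mul hp0.ne' h.ne', mul_assoc]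
    congr 3
    ring
  · refine tsum_congr fun α => ?_
    have h := stringProb_pos hp0 hp1 α
    rw [stringProb_cons, letterProb, if_neg (by simp), Real.log_mul hq.ne' h.ne', mul_assoc]
    congr 3
    ring

/-- Useful near `-∞`: it starts the induction for the uniform bound and fixes constants of summation
and integration. -/
lemma exists_renewalSum_wt_le_exp (hp0 : 0 < p) (hp1 : p < 1) :
    ∃ A, 0 ≤ A ∧ ∀ t, renewalSum p wt t ≤ A * Real.exp t := by
  refine ⟨∑' α, stringProb p α ^ 2, tsum_nonneg fun _ => sq_nonneg _, fun t => ?_⟩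
  rw [mul_comm, ← tsum_mul_left]
  exact (summable_wt_renewal hp0 hp1 t).tsum_le_tsum
    (fun α => stringProb_mul_wt_le hp0 hp1 α t) ((summable_stringProb_sq hp0 hp1).mul_left _)

/-- For `t ≥ 0`, `K - e^{-t}` is a supersolution: since `p e^a = q e^b = 1`, averaging its
translates gives `K - 2e^{-t}`, and the forcing term adds at most `e^{-t}`. The bound spreads from
`[-max(a,b), 0]` to the right in steps of `min(a,b)`. -/
lemma exists_renewalSum_wt_le (hp0 : 0 < p) (hp1 : p < 1) :
    ∃ K, 0 ≤ K ∧ ∀ t, renewalSum p wt t ≤ K := by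
  obtain ⟨A, hA, hle⟩ := exists_renewalSum_wt_le_exp hp0 hp1
  have hq : 0 < 1 - p := by linarith
  set a := -Real.log p with ha
  set b := -Real.log (1 - p) with hb
  have ha0 : 0 < a := neg_pos.2 (Real.log_neg hp0 hp1)
  have hb0 : 0 < b := neg_pos.2 (Real.log_neg hq (by linarith))
  have hpa : p * Real.exp a = 1 := by
    rw [ha, Real.exp_neg, Real.exp_log hp0, mul_inv_cancel₀ hp0.ne']
  have hqb : (1 - p) * Real.exp b = 1 := by
    rw [hb, Real.exp_neg, Real.exp_log hq, mul_inv_cancel₀ hq.ne']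
  set m := max a b
  set c := min a b
  have hc : 0 < c := lt_min ha0 hb0
  -- On `[-m, 0]` the sum is at most `A` and `e^{-t} ≤ e^m`, so this `K` starts the induction.
  set K := Real.exp m + A
  have base : ∀ t, t ≤ 0 → -m ≤ t → renewalSum p wt t ≤ K - Real.exp (-t) := by
    intro t ht htm
    have h1 : Real.exp (-t) ≤ Real.exp m := Real.exp_le_exp.2 (by linarith)
    have h2 : A * Real.exp t ≤ A := mul_le_of_le_one_right hA (Real.exp_le_one_iff.2 ht)
    have := hle t
    simp only [K]
    linarith
  have main : ∀ n : ℕ, ∀ t, t ≤ n * c → -m ≤ t → renewalSum p wt t ≤ K - Real.exp (-t) := by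
    intro n
    induction n with
    | zero => intro t ht; exact base t (by simpa using ht)
    | succ n ih =>
      intro t ht htm
      rcases le_total t 0 with h | h
      · exact base t h htm
      push_cast at ht
      have hca : c ≤ a := min_le_left _ _
      have hcb : c ≤ b := min_le_right _ _
      have ham : a ≤ m := le_max_left _ _
      have hbm : b ≤ m := le_max_right _ _
      have h1 := ih (t - a) (by linarith) (by linarith)
      have h2 := ih (t - b) (by linarith) (by linarith)
      have e1 : Real.exp (-(t - a)) = Real.exp (-t) * Real.exp a := by
        rw [← Real.exp_add]; congr 1; ring
      have e2 : Real.exp (-(t - b)) = Real.exp (-t) * Real.exp b := by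
        rw [← Real.exp_add]; congr 1; ring
      rw [e1] at h1
      rw [e2] at h2
      rw [renewalSum_eq hp0 hp1 (g := wt) (C := 1)
        (fun x => by rw [one_mul, abs_of_pos (wt_pos x)])]
      have h3 : wt (-t) ≤ Real.exp (-t) := wt_le_exp _
      have h4 := mul_le_mul_of_nonneg_left h1 hp0.le
      have h5 := mul_le_mul_of_nonneg_left h2 hq.le
      have e3 : p * (K - Real.exp (-t) * Real.exp a) = p * K - Real.exp (-t) := by
        linear_combination (-Real.exp (-t)) * hpa
      have e4 : (1 - p) * (K - Real.exp (-t) * Real.exp b) = (1 - p) * K - Real.exp (-t) := by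
        linear_combination (-Real.exp (-t)) * hqb
      linarith
  refine ⟨K, add_nonneg (Real.exp_pos _).le hA, fun t => ?_⟩
  rcases le_total t 0 with h | h
  · have h2 : A * Real.exp t ≤ A := mul_le_of_le_one_right hA (Real.exp_le_one_iff.2 h)
    exact (hle t).trans (h2.trans (le_add_of_nonneg_left (Real.exp_pos _).le))
  · obtain ⟨n, hn⟩ := exists_nat_ge (t / c)
    have := main n t ((div_le_iff₀ hc).1 hn) (by linarith [ha0, le_max_left a b])
    linarith [Real.exp_pos (-t)]

end Strings

/-! ### The maximum principle and the semigroup generated by the two letter lengths -/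

/-- If an average with positive weights is near `M` and neither term exceeds `M` by much, then each
term is near `M`. -/
lemma tendsto_shift_left {h : ℝ → ℝ} {p q a b M : ℝ} (hp : 0 < p) (hq : 0 < q) (hpq : p + q = 1)
    (hM : ∀ ε > 0, ∀ᶠ t in atTop, h t < M + ε)
    (hd : Tendsto (fun t => h t - (p * h (t - a) + q * h (t - b))) atTop (𝓝 0))
    {l : Filter ℝ} (hl : l ≤ atTop) (hh : Tendsto h l (𝓝 M)) :
    Tendsto (fun t => h (t - a)) l (𝓝 M) := by
  have hdl := hd.mono_left hl
  have hb : ∀ ε > 0, ∀ᶠ t in l, h (t - b) < M + ε := fun ε hε =>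
    hl ((tendsto_atTop_add_const_right atTop (-b) tendsto_id).eventually (hM ε hε))
  have ha : ∀ ε > 0, ∀ᶠ t in l, h (t - a) < M + ε := fun ε hε =>
    hl ((tendsto_atTop_add_const_right atTop (-a) tendsto_id).eventually (hM ε hε))
  rw [tendsto_order]
  constructor
  · intro c hc
    -- Three errors of this size are lost: in `h t`, in the defect of the equation and in `h (t -
    -- b)`. Together they leave `p h(t - a) > pM - p(M - c) = pc`.
    have hε : 0 < p * (M - c) / 3 := by have := sub_pos.2 hc; positivity
    filter_upwards [hb _ hε, hdl.eventually (gt_mem_nhds hε),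
      hh.eventually (lt_mem_nhds (show M - p * (M - c) / 3 < M by linarith))] with t h1 h2 h3
    have h4 : q * h (t - b) ≤ q * (M + p * (M - c) / 3) :=
      mul_le_mul_of_nonneg_left h1.le hq.le
    have h5 : q * (p * (M - c) / 3) < p * (M - c) / 3 :=
      mul_lt_of_lt_one_left hε (by linarith)
    have h6 : p * c < p * h (t - a) := by
      have : q = 1 - p := by linarith
      have h7 : q * M = M - p * M := by rw [this]; ring
      nlinarith
    exact lt_of_mul_lt_mul_left h6 hp.le
  · intro c hc
    filter_upwards [ha (c - M) (by linarith)] with t ht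
    linarith

lemma tendsto_shift {h : ℝ → ℝ} {p q a b M : ℝ} (hp : 0 < p) (hq : 0 < q) (hpq : p + q = 1)
    (hM : ∀ ε > 0, ∀ᶠ t in atTop, h t < M + ε)
    (hd : Tendsto (fun t => h t - (p * h (t - a) + q * h (t - b))) atTop (𝓝 0))
    {l : Filter ℝ} (hl : l ≤ atTop) (hh : Tendsto h l (𝓝 M)) (j k : ℕ) :
    Tendsto (fun t => h (t - (j * a + k * b))) l (𝓝 M) := by
  have hsub : ∀ c : ℝ, map (fun t => t - c) l ≤ atTop := fun c =>
    (tendsto_atTop_add_const_right atTop (-c) tendsto_id).mono_left hl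
  have hd' : Tendsto (fun t => h t - (q * h (t - b) + p * h (t - a))) atTop (𝓝 0) := by
    simpa only [add_comm] using hd
  induction k with
  | zero =>
    induction j with
    | zero => simpa using hh
    | succ j ih =>
      -- The one-step lemma is used along the translated filter, which is still finer than `atTop`.
      have := tendsto_shift_left hp hq hpq hM hd (hsub (j * a)) (h := h)
        (by simpa [Function.comp_def] using ih)
      refine (tendsto_map'_iff.1 this).congr fun t => ?_
      simp only [Function.comp]
      congr 1
      push_cast
      ring
  | succ k ih =>
    have := tendsto_shift_left hq hp (by linarith) hM hd' (hsub (j * a + k * b)) (h := h)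
      (by simpa [Function.comp_def] using ih)
    refine (tendsto_map'_iff.1 this).congr fun t => ?_
    simp only [Function.comp]
    congr 1
    push_cast
    ring

/-- A bounded asymptotic solution of the homogeneous renewal equation is close to its upper
limit `M` along a filter, together with all its translates by the renewal semigroup. -/
lemma exists_filter_tendsto_shift {h : ℝ → ℝ} {p q a b B : ℝ} (hp : 0 < p) (hq : 0 < q)
    (hpq : p + q = 1) (hB : ∀ t, |h t| ≤ B)
    (hd : Tendsto (fun t => h t - (p * h (t - a) + q * h (t - b))) atTop (𝓝 0)) :
    ∃ (M : ℝ) (l : Filter ℝ), l.NeBot ∧ l ≤ atTop ∧ (∀ ε > 0, ∀ᶠ t in atTop, h t < M + ε) ∧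
      ∀ j k : ℕ, Tendsto (fun t => h (t - (j * a + k * b))) l (𝓝 M) := by
  have hbd : IsBoundedUnder (· ≤ ·) atTop h :=
    isBoundedUnder_of ⟨B, fun t => (abs_le.1 (hB t)).2⟩
  have hbd' : IsBoundedUnder (· ≥ ·) atTop h :=
    isBoundedUnder_of ⟨-B, fun t => (abs_le.1 (hB t)).1⟩
  set M := limsup h atTop
  have hM : ∀ ε > 0, ∀ᶠ t in atTop, h t < M + ε := fun ε hε =>
    eventually_lt_of_limsup_lt (lt_add_of_pos_right M hε) hbd
  -- The upper limit of a bounded function is a cluster value, so `t → ∞` together with `h t → M`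
  -- defines a proper filter.
  have hne : (atTop ⊓ comap h (𝓝 M)).NeBot := by
    have hc : MapClusterPt M atTop h := MapClusterPt.limsup hbd'.isCoboundedUnder_le hbd
    rw [MapClusterPt, ClusterPt] at hc
    exact neBot_inf_comap_iff_map.2 (by rwa [inf_comm])
  refine ⟨M, atTop ⊓ comap h (𝓝 M), hne, inf_le_left, hM, ?_⟩
  exact tendsto_shift hp hq hpq hM hd inf_le_left (tendsto_comap.mono_left inf_le_right)

/-- The semigroup generated by two incommensurable numbers, one of them positive,
is asymptotically dense. -/
lemma exists_forall_abs_sub_lt {a b : ℝ} (ha : 0 < a) (hab : Irrational (a / b))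
    {δ : ℝ} (hδ : 0 < δ) : ∃ L : ℝ, ∀ s, L ≤ s → ∃ j k : ℕ, |s - (j * a + k * b)| < δ := by
  -- Density of the group yields `ξ = ma + nb` in `(0, δ)`, with integers `m, n` of unknown sign.
  have hD := dense_addSubgroupClosure_pair_iff.2 hab
  obtain ⟨ξ, ⟨hξ0, hξδ⟩, hξ⟩ := hD.exists_mem_open isOpen_Ioo (nonempty_Ioo.2 hδ) |>.imp
    fun _ h => And.symm h
  obtain ⟨m, n, hmn⟩ := AddSubgroup.mem_closure_pair.1 hξ
  simp only [zsmul_eq_mul] at hmn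
  set R := ⌊a / ξ⌋₊
  -- Starting from `N(a + b)` leaves room to add `rξ` for every `r ≤ R` while both coefficients stay
  -- non-negative. Multiples of `a` bring the remainder into `[0, a)`, and at most `R` copies of `ξ`
  -- bring it below `δ`.
  set N := R * (m.natAbs + n.natAbs)
  refine ⟨N * (a + b), fun s hs => ?_⟩
  set s' := s - N * (a + b)
  have hs' : 0 ≤ s' := sub_nonneg.2 hs
  set k := ⌊s' / a⌋₊
  have hk1 : k * a ≤ s' := (le_div_iff₀ ha).1 (Nat.floor_le (by positivity))
  have hk2 : s' < (k + 1) * a := (div_lt_iff₀ ha).1 (Nat.lt_floor_add_one _)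
  set u := s' - k * a
  have hu0 : 0 ≤ u := sub_nonneg.2 hk1
  have hua : u ≤ a := by simp only [u]; linarith
  set r := ⌊u / ξ⌋₊
  have hr1 : r * ξ ≤ u := (le_div_iff₀ hξ0).1 (Nat.floor_le (by positivity))
  have hr2 : u < (r + 1) * ξ := (div_lt_iff₀ hξ0).1 (Nat.lt_floor_add_one _)
  have hrR : r ≤ R := Nat.floor_mono (by gcongr)
  have hJ : ∀ z : ℤ, (z.natAbs ≤ m.natAbs + n.natAbs) → 0 ≤ (N : ℤ) + r * z := by
    intro z hz
    have h1 : (r : ℤ) * z.natAbs ≤ N := by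
      exact_mod_cast Nat.mul_le_mul hrR hz
    have h2 : -(z.natAbs : ℤ) ≤ z := by omega
    nlinarith
  obtain ⟨j₁, hj₁⟩ := Int.eq_ofNat_of_zero_le (hJ m (by omega))
  obtain ⟨k₁, hk₁⟩ := Int.eq_ofNat_of_zero_le (hJ n (by omega))
  refine ⟨k + j₁, k₁, ?_⟩
  have e1 : (j₁ : ℝ) = N + r * m := by exact_mod_cast hj₁.symm
  have e2 : (k₁ : ℝ) = N + r * n := by exact_mod_cast hk₁.symm
  have e3 : s - ((k + j₁ : ℕ) * a + k₁ * b) = u - r * ξ := by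
    push_cast
    rw [e1, e2, ← hmn]
    simp only [u, s']
    ring
  rw [e3, abs_of_nonneg (by linarith)]
  linarith

/-! ### Lattice windows and vanishing at infinity -/

/-- From the Frobenius bound `N = (i - 1)(j - 1)` on, every integer has the form `ri + sj`. Hence
all terms of the window at `t - Nd` tend to `M` along the filter; the window tends to `(pi + qj)M`
and also to `0`, so `M = 0`. -/
lemma eventually_lt_of_window {h : ℝ → ℝ} {p q d B : ℝ} {i j : ℕ} (hp : 0 < p) (hq : 0 < q)
    (hpq : p + q = 1) (hi : 0 < i) (hj : 0 < j) (hij : Nat.Coprime i j) (hB : ∀ t, |h t| ≤ B)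
    (hd : Tendsto (fun t => h t - (p * h (t - i * d) + q * h (t - j * d))) atTop (𝓝 0))
    (hJ : Tendsto (fun t => p * ∑ m ∈ Finset.range i, h (t - m * d)
      + q * ∑ m ∈ Finset.range j, h (t - m * d)) atTop (𝓝 0)) :
    ∀ ε > 0, ∀ᶠ t in atTop, h t < ε := by
  obtain ⟨M, l, hne, hl, hM, hsh⟩ := exists_filter_tendsto_shift hp hq hpq hB hd
  set N := (i - 1) * (j - 1)
  have hlim : ∀ m : ℕ, Tendsto (fun t => h (t - N * d - m * d)) l (𝓝 M) := by
    intro m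
    obtain ⟨r, s, hrs⟩ := Nat.exists_add_mul_eq_of_gcd_dvd_of_mul_pred_le i j (N + m)
      (by simp [hij.gcd_eq_one]) (by simp [N])
    refine (hsh r s).congr fun t => ?_
    have : (r * i + s * j : ℝ) = N + m := by exact_mod_cast hrs
    congr 1
    linear_combination (-d) * this
  have h1 : Tendsto (fun t => p * ∑ m ∈ Finset.range i, h (t - N * d - m * d)
      + q * ∑ m ∈ Finset.range j, h (t - N * d - m * d)) l
      (𝓝 (p * ∑ _m ∈ Finset.range i, M + q * ∑ _m ∈ Finset.range j, M)) :=
    ((tendsto_finsetSum _ fun m _ => hlim m).const_mul p).add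
      ((tendsto_finsetSum _ fun m _ => hlim m).const_mul q)
  have h2 := (hJ.comp ((tendsto_atTop_add_const_right atTop (-(N * d)) tendsto_id).mono_left hl))
  have h3 := tendsto_nhds_unique h1 h2
  simp only [Finset.sum_const, Finset.card_range, nsmul_eq_mul] at h3
  have hM0 : M = 0 := by
    have h4 : 0 < p * i + q * j := by positivity
    have h5 : (p * i + q * j) * M = 0 := by linarith
    exact (mul_eq_zero.1 h5).resolve_left h4.ne'
  intro ε hε
  simpa [hM0] using hM ε hε

lemma tendsto_zero_of_window {h : ℝ → ℝ} {p q d B : ℝ} {i j : ℕ} (hp : 0 < p) (hq : 0 < q)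
    (hpq : p + q = 1) (hi : 0 < i) (hj : 0 < j) (hij : Nat.Coprime i j) (hB : ∀ t, |h t| ≤ B)
    (hd : Tendsto (fun t => h t - (p * h (t - i * d) + q * h (t - j * d))) atTop (𝓝 0))
    (hJ : Tendsto (fun t => p * ∑ m ∈ Finset.range i, h (t - m * d)
      + q * ∑ m ∈ Finset.range j, h (t - m * d)) atTop (𝓝 0)) :
    Tendsto h atTop (𝓝 0) := by
  have h1 := eventually_lt_of_window hp hq hpq hi hj hij hB hd hJ
  have hd' := hd.neg
  have hJ' := hJ.neg
  rw [neg_zero] at hd' hJ'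
  have h2 := eventually_lt_of_window (h := fun t => -h t) (d := d) hp hq hpq hi hj hij
    (fun t => by simpa using hB t) (hd'.congr fun t => by ring)
    (hJ'.congr fun t => by simp only [Finset.sum_neg_distrib]; ring)
  rw [tendsto_order]
  refine ⟨fun c hc => ?_, fun c hc => h1 c hc⟩
  filter_upwards [h2 (-c) (by linarith)] with t ht
  linarith

/-! ### Sums of `g` over translates of a lattice -/

section Periodization

variable {d C : ℝ} {g : ℝ → ℝ}

lemma summable_nat_wt (hd : 0 < d) : Summable fun k : ℕ => wt (k * d) := by
  have h : ∀ k : ℕ, wt (k * d) = Real.exp (-d) ^ k := by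
    intro k
    rw [← Real.exp_nat_mul, wt, abs_of_nonneg (by positivity)]
    congr 1
    ring
  simp_rw [h]
  exact summable_geometric_of_lt_one (Real.exp_pos _).le (Real.exp_lt_one_iff.2 (by linarith))

lemma summable_int_wt (hd : 0 < d) : Summable fun k : ℤ => wt (k * d) := by
  refine Summable.of_nat_of_neg (by simpa using summable_nat_wt hd) ?_
  refine (summable_nat_wt hd).congr fun k => ?_
  rw [← wt_neg]
  congr 1
  push_cast
  ring

lemma abs_le_exp_mul_wt (hg : ∀ x, |g x| ≤ C * wt x) (x t : ℝ) :
    |g (x - t)| ≤ C * Real.exp |t| * wt x := by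
  have hC : 0 ≤ C := nonneg_of_abs_le_wt hg
  have h := wt_le_exp_mul (x - t) x
  rw [show x - t - x = -t by ring, abs_neg] at h
  calc |g (x - t)| ≤ C * wt (x - t) := hg _
    _ ≤ C * (Real.exp |t| * wt x) := by gcongr
    _ = _ := by ring

lemma summable_int_translates (hd : 0 < d) (hg : ∀ x, |g x| ≤ C * wt x) (t : ℝ) :
    Summable fun k : ℤ => g (k * d - t) :=
  Summable.of_norm_bounded ((summable_int_wt hd).mul_left (C * Real.exp |t|))
    fun k => abs_le_exp_mul_wt hg (k * d) t

lemma periodic_tsum_translates (g : ℝ → ℝ) (d : ℝ) :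
    Function.Periodic (fun t => ∑' k : ℤ, g (k * d - t)) d := by
  intro t
  simp only
  rw [← (Equiv.addRight (1 : ℤ)).tsum_eq]
  refine tsum_congr fun k => ?_
  congr 1
  simp only [Equiv.coe_addRight]
  push_cast
  ring

lemma exists_abs_tsum_translates_le (hd : 0 < d) (hg : ∀ x, |g x| ≤ C * wt x) :
    ∃ B, ∀ t, |∑' k : ℤ, g (k * d - t)| ≤ B := by
  have hC : 0 ≤ C := nonneg_of_abs_le_wt hg
  -- By periodicity only `0 ≤ t < d` matters, where translation costs a factor at most `e^d`.
  refine ⟨C * Real.exp d * ∑' k : ℤ, wt (k * d), fun t => ?_⟩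
  obtain ⟨s, hs, hst⟩ := (periodic_tsum_translates g d).exists_mem_Ico₀ hd t
  rw [hst, ← Real.norm_eq_abs, ← tsum_mul_left]
  refine tsum_of_norm_bounded ((summable_int_wt hd).mul_left (C * Real.exp d)).hasSum fun k => ?_
  refine (abs_le_exp_mul_wt hg (k * d) s).trans ?_
  rw [abs_of_nonneg hs.1]
  have := wt_pos (k * d)
  gcongr
  exact hs.2.le

lemma continuous_tsum_translates (hd : 0 < d) (hg : ∀ x, |g x| ≤ C * wt x) (hgc : Continuous g) :
    Continuous fun t => ∑' k : ℤ, g (k * d - t) := by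
  have hC : 0 ≤ C := nonneg_of_abs_le_wt hg
  rw [continuous_iff_continuousAt]
  intro t₀
  have h : ContinuousOn (fun t => ∑' k : ℤ, g (k * d - t)) (Ioo (-(|t₀| + 1)) (|t₀| + 1)) := by
    refine continuousOn_tsum (u := fun k : ℤ => C * Real.exp (|t₀| + 1) * wt (k * d))
      (fun k => by fun_prop) ((summable_int_wt hd).mul_left _) fun k t ht => ?_
    refine (abs_le_exp_mul_wt hg (k * d) t).trans ?_
    have := wt_pos (k * d)
    gcongr
    exact abs_le.2 ⟨ht.1.le, ht.2.le⟩
  refine h.continuousAt (Ioo_mem_nhds ?_ ?_)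
  · linarith [neg_abs_le t₀]
  · linarith [le_abs_self t₀]

/-- This is the part of the full lattice sum missing from the window sum over `k ≥ 0`; for `t ≥ 0`
its terms are at most `C e^{-t} wt(kd)`. -/
lemma tendsto_tsum_neg_translates (hd : 0 < d) (hg : ∀ x, |g x| ≤ C * wt x) :
    Tendsto (fun t => ∑' k : ℕ, g ((-(k + 1) : ℝ) * d - t)) atTop (𝓝 0) := by
  have hC : 0 ≤ C := nonneg_of_abs_le_wt hg
  have hlim : Tendsto (fun t => C * Real.exp (-t) * ∑' k : ℕ, wt (k * d)) atTop (𝓝 0) := by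
    simpa using (Real.tendsto_exp_neg_atTop_nhds_zero.const_mul C).mul_const
      (∑' k : ℕ, wt (k * d))
  refine squeeze_zero_norm' ?_ hlim
  filter_upwards [eventually_ge_atTop 0] with t ht
  rw [← tsum_mul_left]
  refine tsum_of_norm_bounded ((summable_nat_wt hd).mul_left (C * Real.exp (-t))).hasSum fun k => ?_
  refine (hg _).trans ?_
  rw [mul_assoc]
  refine mul_le_mul_of_nonneg_left ?_ hC
  rw [wt, wt, ← Real.exp_add]
  refine Real.exp_le_exp.2 ?_
  have h1 : (0 : ℝ) ≤ k * d := by positivity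
  rw [abs_of_nonneg h1, abs_of_nonpos (by nlinarith)]
  nlinarith

end Periodization

/-! ### The renewal theorem in the arithmetic case -/

/-- Both sums telescope. The window therefore changes, under a shift by `d`, exactly by the defect
in the homogeneous renewal equation. -/
lemma window_sub_eq {h : ℝ → ℝ} {p q d : ℝ} {i j : ℕ} (hpq : p + q = 1) (t : ℝ) :
    (p * ∑ m ∈ Finset.range i, h (t - m * d) + q * ∑ m ∈ Finset.range j, h (t - m * d))
      - (p * ∑ m ∈ Finset.range i, h (t - d - m * d) + q * ∑ m ∈ Finset.range j, h (t - d - m * d))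
      = h t - (p * h (t - i * d) + q * h (t - j * d)) := by
  have key : ∀ n : ℕ, ∑ m ∈ Finset.range n, h (t - m * d)
      - ∑ m ∈ Finset.range n, h (t - d - m * d) = h t - h (t - n * d) := by
    intro n
    rw [← Finset.sum_sub_distrib]
    have := Finset.sum_range_sub' (fun m : ℕ => h (t - m * d)) n
    simp only [Nat.cast_zero, zero_mul, sub_zero] at this
    rw [← this]
    refine Finset.sum_congr rfl fun m _ => ?_
    congr 2
    push_cast
    ring
  linear_combination p * key i + q * key j + h t * hpq

section Arithmetic

variable {p d C : ℝ} {g : ℝ → ℝ} {i j : ℕ}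

lemma tendsto_renewalSum_sub (hp0 : 0 < p) (hp1 : p < 1) (hg : ∀ x, |g x| ≤ C * wt x) :
    Tendsto (fun t => renewalSum p g t - (p * renewalSum p g (t - -Real.log p)
      + (1 - p) * renewalSum p g (t - -Real.log (1 - p)))) atTop (𝓝 0) := by
  have hlim : Tendsto (fun t => C * Real.exp (-t)) atTop (𝓝 0) := by
    simpa using Real.tendsto_exp_neg_atTop_nhds_zero.const_mul C
  refine squeeze_zero_norm (fun t => ?_) hlim
  have hC : 0 ≤ C := nonneg_of_abs_le_wt hg
  have e := renewalSum_eq hp0 hp1 hg t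
  rw [show renewalSum p g t - (p * renewalSum p g (t - -Real.log p)
      + (1 - p) * renewalSum p g (t - -Real.log (1 - p))) = g (-t) by linarith]
  exact (hg _).trans (mul_le_mul_of_nonneg_left (wt_le_exp _) hC)

/-- The window satisfies `J(t) - J(t - d) = g(-t)` and vanishes at `-∞`; summing the increments
along `t - kd` recovers it. -/
lemma hasSum_window (hp0 : 0 < p) (hp1 : p < 1) (hg : ∀ x, |g x| ≤ C * wt x) (hd : 0 < d)
    (hi : -Real.log p = i * d) (hj : -Real.log (1 - p) = j * d) (t : ℝ) :
    HasSum (fun k : ℕ => g (k * d - t)) (p * ∑ m ∈ Finset.range i, renewalSum p g (t - m * d)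
      + (1 - p) * ∑ m ∈ Finset.range j, renewalSum p g (t - m * d)) := by
  obtain ⟨A, hA, hle⟩ := exists_renewalSum_wt_le_exp hp0 hp1
  have hC : 0 ≤ C := nonneg_of_abs_le_wt hg
  set J : ℝ → ℝ := fun t => p * ∑ m ∈ Finset.range i, renewalSum p g (t - m * d)
      + (1 - p) * ∑ m ∈ Finset.range j, renewalSum p g (t - m * d) with hJ
  have hstep : ∀ t, J t - J (t - d) = g (-t) := by
    intro t
    rw [hJ]
    simp only
    rw [window_sub_eq (by ring) t, ← hi, ← hj]
    linarith [renewalSum_eq hp0 hp1 hg t]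
  have hbot : Tendsto (renewalSum p g) atBot (𝓝 0) := by
    have hlim : Tendsto (fun t => C * (A * Real.exp t)) atBot (𝓝 0) := by
      simpa using (Real.tendsto_exp_atBot.const_mul A).const_mul C
    exact squeeze_zero_norm (fun t => (abs_renewalSum_le hp0 hp1 hg t).trans
      (mul_le_mul_of_nonneg_left (hle t) hC)) hlim
  have hJbot : Tendsto J atBot (𝓝 0) := by
    have hs : ∀ m : ℕ, Tendsto (fun t => renewalSum p g (t - m * d)) atBot (𝓝 0) := fun m =>
      hbot.comp (tendsto_atBot_add_const_right atBot (-(m * d)) tendsto_id)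
    simpa using ((tendsto_finsetSum (Finset.range i) fun m _ => hs m).const_mul p).add
      ((tendsto_finsetSum (Finset.range j) fun m _ => hs m).const_mul (1 - p))
  have hsum : Summable fun k : ℕ => g (k * d - t) := by
    have := (summable_int_translates hd hg t).comp_injective Nat.cast_injective
    simpa [Function.comp_def] using this
  refine (hsum.hasSum_iff_tendsto_nat).2 ?_
  have hpart : ∀ n : ℕ, ∑ k ∈ Finset.range n, g (k * d - t) = J t - J (t - n * d) := by
    intro n
    have := Finset.sum_range_sub' (fun m : ℕ => J (t - m * d)) n
    simp only [Nat.cast_zero, zero_mul, sub_zero] at this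
    rw [← this]
    refine Finset.sum_congr rfl fun m _ => ?_
    have := hstep (t - m * d)
    rw [show t - m * d - d = t - (m + 1 : ℕ) * d by push_cast; ring, neg_sub] at this
    exact this.symm
  simp_rw [hpart]
  have h1 : Tendsto (fun n : ℕ => t - n * d) atTop atBot := by
    have := (tendsto_natCast_atTop_atTop (R := ℝ)).atTop_mul_const hd
    simpa [sub_eq_add_neg] using
      tendsto_atBot_add_const_left atTop t (tendsto_neg_atTop_atBot.comp this)
  simpa using (tendsto_const_nhds (x := J t)).sub (hJbot.comp h1)

/-- The renewal theorem in the arithmetic case. -/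
lemma tendsto_renewalSum_arithmetic (hp0 : 0 < p) (hp1 : p < 1) (hg : ∀ x, |g x| ≤ C * wt x)
    (hd : 0 < d) (hi0 : 0 < i) (hj0 : 0 < j) (hij : Nat.Coprime i j)
    (hi : -Real.log p = i * d) (hj : -Real.log (1 - p) = j * d) :
    Tendsto (fun t => renewalSum p g t - 1 / entropy p * (d * ∑' k : ℤ, g (k * d - t)))
      atTop (𝓝 0) := by
  have hq : 0 < 1 - p := by linarith
  have hC : 0 ≤ C := nonneg_of_abs_le_wt hg
  obtain ⟨K, hK, hKle⟩ := exists_renewalSum_wt_le hp0 hp1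
  obtain ⟨B, hB⟩ := exists_abs_tsum_translates_le hd hg
  set G : ℝ → ℝ := fun t => ∑' k : ℤ, g (k * d - t)
  have hG : Function.Periodic G d := periodic_tsum_translates g d
  have hGn : ∀ (n : ℕ) t, G (t - n * d) = G t := fun n t => hG.sub_nat_mul_eq n
  -- The mean letter length in units of `d`, so that `H = dμ`.
  set μ := p * i + (1 - p) * j
  have hμ : 0 < μ := by positivity
  have hH : entropy p = d * μ := by
    simp only [entropy, μ]
    linear_combination p * hi + (1 - p) * hj
  have hfac : 1 / entropy p * d = 1 / μ := by rw [hH]; field_simp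
  have hdef := tendsto_renewalSum_sub hp0 hp1 hg
  rw [hi, hj] at hdef
  refine tendsto_zero_of_window (i := i) (j := j) (d := d) (B := C * K + 1 / μ * B) hp0 hq
    (by ring) hi0 hj0 hij ?_ ?_ ?_
  · intro t
    rw [← mul_assoc, hfac]
    refine (abs_sub _ _).trans (add_le_add ((abs_renewalSum_le hp0 hp1 hg t).trans
      (mul_le_mul_of_nonneg_left (hKle t) hC)) ?_)
    rw [abs_mul, abs_of_pos (by positivity)]
    exact mul_le_mul_of_nonneg_left (hB t) (by positivity)
  · refine hdef.congr fun t => ?_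
    change _ = _ - 1 / entropy p * (d * G t) - (p * (_ - 1 / entropy p * (d * G (t - i * d)))
      + (1 - p) * (_ - 1 / entropy p * (d * G (t - j * d))))
    rw [hGn, hGn]
    ring
  -- The periodic candidate `G/μ` is constant along the lattice, so its window is `G(t)`. The window
  -- of the difference is thus minus the part of the lattice sum with `k < 0`.
  · have h0 := (tendsto_tsum_neg_translates hd hg).neg
    rw [neg_zero] at h0
    refine h0.congr fun t => ?_
    have hG1 : G t = ∑' k : ℕ, g (k * d - t) + ∑' k : ℕ, g ((-(k + 1) : ℝ) * d - t) := by
      have hs := summable_int_translates hd hg t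
      have h1 : Summable fun k : ℕ => g (((k : ℕ) : ℤ) * d - t) :=
        hs.comp_injective Nat.cast_injective
      have h2 : Summable fun k : ℕ => g (((-((k : ℤ) + 1) : ℤ) : ℝ) * d - t) :=
        hs.comp_injective (i := fun k : ℕ => -((k : ℤ) + 1)) fun x y hxy => by simpa using hxy
      have := tsum_of_nat_of_neg_add_one (f := fun k : ℤ => g (k * d - t)) h1 h2
      simpa using this
    have hW := (hasSum_window hp0 hp1 hg hd hi hj t).tsum_eq
    change _ = p * ∑ m ∈ Finset.range i, (renewalSum p g (t - m * d)
        - 1 / entropy p * (d * G (t - m * d)))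
      + (1 - p) * ∑ m ∈ Finset.range j, (renewalSum p g (t - m * d)
        - 1 / entropy p * (d * G (t - m * d)))
    simp only [hGn, Finset.sum_sub_distrib, Finset.sum_const, Finset.card_range, nsmul_eq_mul]
    rw [← mul_assoc (1 / entropy p), hfac]
    have h3 : p * (i * (1 / μ * G t)) + (1 - p) * (j * (1 / μ * G t)) = G t := by
      simp only [μ]
      field_simp
    linarith

end Arithmetic

/-! ### The non-arithmetic case for `g` with a weighted modulus of continuity -/

lemma abs_intervalIntegral_sub_mul_le {h : ℝ → ℝ} (hc : Continuous h) {M ε x a : ℝ} (ha : 0 ≤ a)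
    (hM : ∀ y, x - a ≤ y → y ≤ x → |h y - M| ≤ ε) :
    |(∫ y in (x - a)..x, h y) - M * a| ≤ ε * a := by
  have e : (∫ y in (x - a)..x, h y) - M * a = ∫ y in (x - a)..x, (h y - M) := by
    rw [intervalIntegral.integral_sub (hc.intervalIntegrable _ _) intervalIntegrable_const,
      intervalIntegral.integral_const, smul_eq_mul]
    ring
  have h2 := intervalIntegral.norm_integral_le_of_norm_le_const (a := x - a) (b := x) (C := ε)
    (f := fun y => h y - M) fun y hy => by
      rw [uIoc_of_le (by linarith)] at hy
      exact hM y hy.1.le hy.2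
  rw [e, ← Real.norm_eq_abs]
  refine h2.trans_eq ?_
  rw [sub_sub_cancel, abs_of_nonneg ha]

section NonArithmetic

variable {p C : ℝ} {g : ℝ → ℝ}

/-- A difference of two values of the renewal sum is the renewal sum of `g(x) - g(x + s - t)`. The
weight in the modulus lets the uniform bound `K` control it. -/
lemma renewalSum_modulus (hp0 : 0 < p) (hp1 : p < 1) (hg : ∀ x, |g x| ≤ C * wt x)
    (hmod : ∀ ε > 0, ∃ δ > 0, ∀ x y, |x - y| < δ → |g x - g y| ≤ ε * wt x) :
    ∀ ε > 0, ∃ δ > 0, ∀ s t, |s - t| < δ → |renewalSum p g s - renewalSum p g t| ≤ ε := by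
  obtain ⟨K, hK, hKle⟩ := exists_renewalSum_wt_le hp0 hp1
  intro ε hε
  obtain ⟨δ, hδ, hle⟩ := hmod (ε / (K + 1)) (by positivity)
  refine ⟨δ, hδ, fun s t hst => ?_⟩
  have h1 : ∀ x, |(fun x => g x - g (x + (s - t))) x| ≤ ε / (K + 1) * wt x := fun x =>
    hle _ _ (by rwa [show x - (x + (s - t)) = -(s - t) by ring, abs_neg])
  have h2 := abs_renewalSum_le hp0 hp1 h1 s
  have h3 : renewalSum p (fun x => g x - g (x + (s - t))) s
      = renewalSum p g s - renewalSum p g t := by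
    rw [renewalSum, renewalSum, renewalSum, ← Summable.tsum_sub (summable_renewal hp0 hp1 hg s)
      (summable_renewal hp0 hp1 hg t)]
    refine tsum_congr fun α => ?_
    rw [mul_sub]
    congr 3
    ring
  rw [h3] at h2
  refine h2.trans ((mul_le_mul_of_nonneg_left (hKle s) (by positivity)).trans ?_)
  rw [div_mul_eq_mul_div, div_le_iff₀ (by positivity)]
  nlinarith

lemma continuous_of_modulus {h : ℝ → ℝ}
    (hmod : ∀ ε > 0, ∃ δ > 0, ∀ s t, |s - t| < δ → |h s - h t| ≤ ε) : Continuous h := by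
  refine Metric.continuous_iff.2 fun t ε hε => ?_
  obtain ⟨δ, hδ, hle⟩ := hmod (ε / 2) (by positivity)
  exact ⟨δ, hδ, fun s hs => (hle s t hs).trans_lt (by linarith)⟩

lemma continuous_of_wt_modulus
    (hmod : ∀ ε > 0, ∃ δ > 0, ∀ x y, |x - y| < δ → |g x - g y| ≤ ε * wt x) : Continuous g :=
  continuous_of_modulus fun ε hε => by
    obtain ⟨δ, hδ, hle⟩ := hmod ε hε
    exact ⟨δ, hδ, fun s t hst => (hle s t hst).trans
      (mul_le_of_le_one_right hε.le (wt_le_one s))⟩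

lemma integrable_of_le_wt (hm : AEStronglyMeasurable g) (hg : ∀ x, |g x| ≤ C * wt x) :
    Integrable g :=
  (integrable_wt.const_mul C).mono' hm (Eventually.of_forall hg)

/-- Averages of the renewal sum over a window of the two letter lengths tend to `∫ g`. -/
lemma tendsto_renewal_average (hp0 : 0 < p) (hp1 : p < 1) (hg : ∀ x, |g x| ≤ C * wt x)
    (hgc : Continuous g) (hc : Continuous (renewalSum p g)) :
    Tendsto (fun t => p * (∫ y in (t - -Real.log p)..t, renewalSum p g y)
      + (1 - p) * ∫ y in (t - -Real.log (1 - p))..t, renewalSum p g y) atTop (𝓝 (∫ x, g x)) := by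
  obtain ⟨A, hA, hle⟩ := exists_renewalSum_wt_le_exp hp0 hp1
  have hq : 0 < 1 - p := by linarith
  have hC : 0 ≤ C := nonneg_of_abs_le_wt hg
  have ha0 : 0 < -Real.log p := neg_pos.2 (Real.log_neg hp0 hp1)
  have hb0 : 0 < -Real.log (1 - p) := neg_pos.2 (Real.log_neg hq (by linarith))
  have heq := renewalSum_eq hp0 hp1 hg
  have hbd : ∀ t, |renewalSum p g t| ≤ C * (A * Real.exp t) := fun t =>
    (abs_renewalSum_le hp0 hp1 hg t).trans (mul_le_mul_of_nonneg_left (hle t) hC)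
  generalize -Real.log p = a at *
  generalize -Real.log (1 - p) = b at *
  generalize renewalSum p g = h at *
  have hbot : ∀ c, 0 < c → Tendsto (fun t => ∫ y in (t - c)..t, h y) atBot (𝓝 0) := by
    intro c hc0
    have hlim : Tendsto (fun t => C * (A * Real.exp t) * c) atBot (𝓝 0) := by
      simpa using ((Real.tendsto_exp_atBot.const_mul A).const_mul C).mul_const c
    refine squeeze_zero_norm (fun t => ?_) hlim
    have := abs_intervalIntegral_sub_mul_le hc (M := 0) (x := t) (ε := C * (A * Real.exp t))
      hc0.le fun y _ hy => by
        rw [sub_zero]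
        refine (hbd y).trans ?_
        gcongr
    simpa using this
  set J : ℝ → ℝ := fun t => p * (∫ y in (t - a)..t, h y) + (1 - p) * ∫ y in (t - b)..t, h y
  set E : ℝ → ℝ := fun t => ∫ s in (0 : ℝ)..t, g (-s)
  have hJbot : Tendsto J atBot (𝓝 0) := by
    simpa using ((hbot a ha0).const_mul p).add ((hbot b hb0).const_mul (1 - p))
  have hgi : Integrable fun s => g (-s) :=
    (integrable_of_le_wt hgc.aestronglyMeasurable hg).comp_neg
  have hEtop : Tendsto E atTop (𝓝 (∫ s in Ioi 0, g (-s))) :=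
    intervalIntegral_tendsto_integral_Ioi 0 hgi.integrableOn tendsto_id
  have hEbot : Tendsto E atBot (𝓝 (-∫ s in Iic 0, g (-s))) := by
    refine (intervalIntegral_tendsto_integral_Iic 0 hgi.integrableOn tendsto_id).neg.congr
      fun t => ?_
    exact (intervalIntegral.integral_symm _ _).symm
  have hderW : ∀ c t, HasDerivAt (fun t => ∫ y in (t - c)..t, h y) (h t - h (t - c)) t := by
    intro c t
    have h0 : ∀ t, HasDerivAt (fun t => ∫ y in (0 : ℝ)..t, h y) (h t) t := fun t =>
      intervalIntegral.integral_hasDerivAt_right (hc.intervalIntegrable _ _)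
        (hc.stronglyMeasurableAtFilter _ _) hc.continuousAt
    have h1 := (h0 t).sub ((h0 (t - c)).comp_sub_const t c)
    refine h1.congr_of_eventuallyEq (Eventually.of_forall fun s => ?_)
    exact (intervalIntegral.integral_interval_sub_left (hc.intervalIntegrable _ _)
      (hc.intervalIntegrable _ _)).symm
  have hderE : ∀ t, HasDerivAt E (g (-t)) t := fun t =>
    intervalIntegral.integral_hasDerivAt_right (hgi.intervalIntegrable)
      ((hgc.comp continuous_neg).stronglyMeasurableAtFilter _ _) (hgc.comp continuous_neg).continuousAt
  -- By the renewal equation `J` and `E` both have derivative `g(-t)`. Their constant difference is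
  -- found at `-∞`, where `J` vanishes.
  have hder : ∀ t, HasDerivAt (fun t => J t - E t) 0 t := by
    intro t
    have := (((hderW a t).const_mul p).add ((hderW b t).const_mul (1 - p))).sub (hderE t)
    refine this.congr_deriv ?_
    linarith [heq t]
  have hconst : ∀ t, J t - E t = J 0 - E 0 := fun t =>
    is_const_of_deriv_eq_zero (fun t => (hder t).differentiableAt) (fun t => (hder t).deriv) t 0
  have h0 : J 0 - E 0 = ∫ s in Iic 0, g (-s) := by
    have h1 := hJbot.sub hEbot
    simp_rw [hconst] at h1
    have := tendsto_nhds_unique tendsto_const_nhds h1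
    linarith
  have hfin : (∫ x, g x) = (J 0 - E 0) + ∫ s in Ioi 0, g (-s) := by
    rw [h0, ← integral_neg_eq_self g, ← setIntegral_univ, ← Iic_union_Ioi (a := (0 : ℝ))]
    exact setIntegral_union (Iic_disjoint_Ioi le_rfl) measurableSet_Ioi hgi.integrableOn
      hgi.integrableOn
  rw [hfin]
  refine (hEtop.const_add _).congr fun t => ?_
  rw [← hconst t]
  ring

/-- Uniform continuity and asymptotic density bring `h` close to `M` on whole windows, so the limit
of the window averages is `M H`. This identifies the upper limit as `∫ g / H`. The sign of `g` is
free, so that `-g` is also covered. -/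
lemma eventually_renewalSum_lt (hp0 : 0 < p) (hp1 : p < 1)
    (hirr : Irrational (Real.log p / Real.log (1 - p))) (hg : ∀ x, |g x| ≤ C * wt x)
    (hmod : ∀ ε > 0, ∃ δ > 0, ∀ x y, |x - y| < δ → |g x - g y| ≤ ε * wt x) :
    ∀ ε > 0, ∀ᶠ t in atTop, renewalSum p g t < 1 / entropy p * (∫ x, g x) + ε := by
  have hq : 0 < 1 - p := by linarith
  have hC : 0 ≤ C := nonneg_of_abs_le_wt hg
  obtain ⟨K, hK, hKle⟩ := exists_renewalSum_wt_le hp0 hp1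
  have ha0 : 0 < -Real.log p := neg_pos.2 (Real.log_neg hp0 hp1)
  have hb0 : 0 < -Real.log (1 - p) := neg_pos.2 (Real.log_neg hq (by linarith))
  have hmodh := renewalSum_modulus hp0 hp1 hg hmod
  have hc := continuous_of_modulus hmodh
  have hJ := tendsto_renewal_average hp0 hp1 hg (continuous_of_wt_modulus hmod) hc
  have hdef := tendsto_renewalSum_sub hp0 hp1 hg
  have hH : entropy p = p * -Real.log p + (1 - p) * -Real.log (1 - p) := by
    rw [entropy]; ring
  rw [← neg_div_neg_eq] at hirr
  obtain ⟨M, l, hne, hl, hM, hsh⟩ := exists_filter_tendsto_shift hp0 hq (by ring)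
    (B := C * K) (fun t => (abs_renewalSum_le hp0 hp1 hg t).trans
      (mul_le_mul_of_nonneg_left (hKle t) hC)) hdef
  suffices hMH : M * entropy p = ∫ x, g x by
    have hpos : 0 < entropy p := by rw [hH]; positivity
    rw [← hMH, one_div, mul_comm M, inv_mul_cancel_left₀ hpos.ne']
    exact hM
  rw [hH]
  generalize -Real.log p = a at *
  generalize -Real.log (1 - p) = b at *
  generalize renewalSum p g = h at *
  have hwin : ∀ ε > 0, ∃ L : ℝ, ∀ᶠ t in l, ∀ c, 0 < c → c ≤ a + b →
      |(∫ y in (t - L - c)..(t - L), h y) - M * c| ≤ ε * c := by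
    intro ε hε
    obtain ⟨δ, hδ, hle⟩ := hmodh (ε / 2) (by positivity)
    obtain ⟨L, hL⟩ := exists_forall_abs_sub_lt ha0 hirr hδ
    -- Only semigroup elements below `L + (a + b) + δ` are needed to reach the windows; these are
    -- finitely many, so their limits along `l` hold simultaneously.
    obtain ⟨N₁, hN₁⟩ := exists_nat_ge ((L + (a + b) + δ) / a)
    obtain ⟨N₂, hN₂⟩ := exists_nat_ge ((L + (a + b) + δ) / b)
    rw [div_le_iff₀ ha0] at hN₁
    rw [div_le_iff₀ hb0] at hN₂
    have hev : ∀ᶠ t in l, ∀ j ∈ Finset.range (N₁ + 1), ∀ k ∈ Finset.range (N₂ + 1),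
        |h (t - (j * a + k * b)) - M| < ε / 2 := by
      simp only [Filter.eventually_all_finset]
      intro j _ k _
      exact (Metric.tendsto_nhds.1 (hsh j k)) (ε / 2) (by positivity)
    refine ⟨L, hev.mono fun t ht c hc0 hcab => ?_⟩
    refine abs_intervalIntegral_sub_mul_le hc hc0.le fun y hy1 hy2 => ?_
    obtain ⟨j, k, hjk⟩ := hL (t - y) (by linarith)
    have hjk' := (abs_lt.1 hjk).1
    have hja : (0 : ℝ) ≤ j * a := by positivity
    have hkb : (0 : ℝ) ≤ k * b := by positivity
    have hj : j < N₁ + 1 := by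
      have : (j : ℝ) * a < (N₁ + 1 : ℕ) * a := by push_cast; linarith
      exact_mod_cast lt_of_mul_lt_mul_right this ha0.le
    have hk : k < N₂ + 1 := by
      have : (k : ℝ) * b < (N₂ + 1 : ℕ) * b := by push_cast; linarith
      exact_mod_cast lt_of_mul_lt_mul_right this hb0.le
    have h1 := ht j (Finset.mem_range.2 hj) k (Finset.mem_range.2 hk)
    have h2 := hle y (t - (j * a + k * b)) (by
      rwa [← abs_neg, show -(y - (t - (j * a + k * b))) = t - y - (j * a + k * b) by ring])
    calc |h y - M| ≤ |h y - h (t - (j * a + k * b))| + |h (t - (j * a + k * b)) - M| :=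
          abs_sub_le _ _ _
      _ ≤ ε := by linarith
  have hsmall : ∀ ε > 0, |M * (p * a + (1 - p) * b) - ∫ x, g x|
      ≤ ε * (p * a + (1 - p) * b) + ε := by
    intro ε hε
    obtain ⟨L, hL⟩ := hwin ε hε
    have hJL := (hJ.comp (tendsto_atTop_add_const_right atTop (-L) tendsto_id)).mono_left hl
    obtain ⟨t, ht, ht2⟩ := (hL.and ((Metric.tendsto_nhds.1 hJL) ε hε)).exists
    have h1 := ht a ha0 (by linarith)
    have h2 := ht b hb0 (by linarith)
    simp only [Function.comp, id, ← sub_eq_add_neg, Real.dist_eq] at ht2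
    rw [abs_le] at h1 h2
    rw [abs_lt] at ht2
    have h11 := mul_le_mul_of_nonneg_left h1.1 hp0.le
    have h12 := mul_le_mul_of_nonneg_left h1.2 hp0.le
    have h21 := mul_le_mul_of_nonneg_left h2.1 hq.le
    have h22 := mul_le_mul_of_nonneg_left h2.2 hq.le
    rw [abs_le]
    constructor <;> linarith [ht2.1, ht2.2]
  set S := p * a + (1 - p) * b
  have hS : 0 < S := by positivity
  refine sub_eq_zero.1 (abs_eq_zero.1 (le_antisymm (le_of_forall_pos_le_add fun ε hε => ?_)
    (abs_nonneg _)))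
  have := hsmall (ε / (S + 1)) (by positivity)
  rw [← mul_add_one, div_mul_cancel₀ _ (by positivity)] at this
  linarith

end NonArithmetic

/-! ### Measurability and Lipschitz envelopes -/

/-- The continuity points form a `Gδ` set of full measure, on which the function is continuous. -/
lemma aestronglyMeasurable_of_ae_continuousAt {g : ℝ → ℝ} (hg : ∀ᵐ x, ContinuousAt g x) :
    AEStronglyMeasurable g := by
  have hG : MeasurableSet {x | ContinuousAt g x} := (IsGδ.setOfPred_continuousAt g).measurableSet
  have h : AEStronglyMeasurable g (volume.restrict {x | ContinuousAt g x}) :=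
    ContinuousOn.aestronglyMeasurable (fun x hx => ContinuousAt.continuousWithinAt hx) hG
  have hmem : ∀ᵐ x, x ∈ {x | ContinuousAt g x} := hg
  rwa [Measure.restrict_eq_self_of_ae_mem hmem] at h

/-- The largest `n`-Lipschitz function below `φ`. -/
noncomputable def lowerEnvelope (φ : ℝ → ℝ) (n : ℕ) (x : ℝ) : ℝ := ⨅ y, (φ y + n * |x - y|)

section Envelope

variable {φ : ℝ → ℝ} {C : ℝ}

lemma lowerEnvelope_bddBelow (h0 : ∀ x, 0 ≤ φ x) (n : ℕ) (x : ℝ) :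
    BddBelow (range fun y => φ y + n * |x - y|) :=
  ⟨0, by rintro _ ⟨y, rfl⟩; have := h0 y; positivity⟩

lemma lowerEnvelope_nonneg (h0 : ∀ x, 0 ≤ φ x) (n : ℕ) (x : ℝ) : 0 ≤ lowerEnvelope φ n x :=
  le_ciInf fun y => by have := h0 y; positivity

lemma lowerEnvelope_le (h0 : ∀ x, 0 ≤ φ x) (n : ℕ) (x : ℝ) : lowerEnvelope φ n x ≤ φ x :=
  (ciInf_le (lowerEnvelope_bddBelow h0 n x) x).trans_eq (by simp)

lemma lowerEnvelope_sub_le (h0 : ∀ x, 0 ≤ φ x) (n : ℕ) (x y : ℝ) :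
    lowerEnvelope φ n x - lowerEnvelope φ n y ≤ n * |x - y| := by
  rw [sub_le_iff_le_add', ← sub_le_iff_le_add]
  refine le_ciInf fun z => ?_
  have h1 := ciInf_le (lowerEnvelope_bddBelow h0 n x) z
  have h2 : (n : ℝ) * |x - z| ≤ n * (|x - y| + |y - z|) := by
    gcongr
    exact abs_sub_le _ _ _
  rw [lowerEnvelope]
  linarith

lemma abs_lowerEnvelope_sub_le (h0 : ∀ x, 0 ≤ φ x) (n : ℕ) (x y : ℝ) :
    |lowerEnvelope φ n x - lowerEnvelope φ n y| ≤ n * |x - y| := by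
  refine abs_le.2 ⟨?_, lowerEnvelope_sub_le h0 n x y⟩
  have := lowerEnvelope_sub_le h0 n y x
  rw [abs_sub_comm] at this
  linarith

/-- In the infimum, nearby `y` have `φ y` almost as large as `φ x`, and distant `y` pay a penalty
growing with `n`. -/
lemma tendsto_lowerEnvelope (h0 : ∀ x, 0 ≤ φ x) {x : ℝ} (hx : ContinuousAt φ x) :
    Tendsto (fun n => lowerEnvelope φ n x) atTop (𝓝 (φ x)) := by
  rw [tendsto_order]
  refine ⟨fun c hc => ?_, fun c hc => Eventually.of_forall fun n =>
    (lowerEnvelope_le h0 n x).trans_lt hc⟩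
  obtain ⟨c', hc1, hc2⟩ := exists_between hc
  obtain ⟨δ, hδ, hball⟩ := Metric.eventually_nhds_iff.1 (hx.eventually (lt_mem_nhds hc2))
  obtain ⟨N, hN⟩ := exists_nat_ge (c' / δ)
  filter_upwards [eventually_ge_atTop N] with n hn
  refine hc1.trans_le (le_ciInf fun y => ?_)
  rcases lt_or_ge |x - y| δ with h | h
  · have h1 := hball (y := y) (by rwa [Real.dist_eq, abs_sub_comm])
    have h2 : (0 : ℝ) ≤ n * |x - y| := by positivity
    linarith
  · have h1 : c' ≤ N * δ := (div_le_iff₀ hδ).1 hN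
    have h2 : (N : ℝ) * δ ≤ n * |x - y| := by gcongr
    linarith [h0 y]

lemma wt_mul_modulus {n : ℕ} (hC : ∀ x, |φ x| ≤ C) (hn : ∀ x y, |φ x - φ y| ≤ n * |x - y|) :
    ∀ ε > 0, ∃ δ > 0, ∀ x y, |x - y| < δ → |wt x * φ x - wt y * φ y| ≤ ε * wt x := by
  intro ε hε
  have hcont : ContinuousAt (fun r : ℝ => (Real.exp |r| - 1) * C + n * |r|) 0 := by fun_prop
  obtain ⟨δ, hδ, hball⟩ := Metric.eventually_nhds_iff.1
    (hcont.eventually (gt_mem_nhds (a := ε) (by simpa using hε)))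
  refine ⟨δ, hδ, fun x y hxy => ?_⟩
  have h1 := hball (y := x - y) (by simpa [Real.dist_eq] using hxy)
  have h2 : |wt x - wt y| * |φ y| ≤ (Real.exp |x - y| - 1) * wt x * C :=
    mul_le_mul (abs_wt_sub_le x y) (hC y) (abs_nonneg _)
      ((abs_nonneg _).trans (abs_wt_sub_le x y))
  have h3 : wt x * |φ x - φ y| ≤ wt x * (n * |x - y|) :=
    mul_le_mul_of_nonneg_left (hn x y) (wt_pos x).le
  calc |wt x * φ x - wt y * φ y| = |(wt x - wt y) * φ y + wt x * (φ x - φ y)| := by ring_nf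
    _ ≤ |wt x - wt y| * |φ y| + wt x * |φ x - φ y| := by
      refine (abs_add_le _ _).trans_eq ?_
      rw [abs_mul, abs_mul, abs_of_pos (wt_pos x)]
    _ ≤ ((Real.exp |x - y| - 1) * C + n * |x - y|) * wt x := by linarith
    _ ≤ ε * wt x := mul_le_mul_of_nonneg_right h1.le (wt_pos x).le

end Envelope

/-! ### The non-arithmetic case for almost everywhere continuous `g` -/

section NonArithmetic

variable {p C : ℝ} {g : ℝ → ℝ}

lemma renewalSum_neg (p : ℝ) (g : ℝ → ℝ) (t : ℝ) :
    renewalSum p (fun x => -g x) t = -renewalSum p g t := by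
  simp only [renewalSum, mul_neg, tsum_neg]

lemma eventually_lt_renewalSum (hp0 : 0 < p) (hp1 : p < 1)
    (hirr : Irrational (Real.log p / Real.log (1 - p))) (hg0 : ∀ x, 0 ≤ g x)
    (hg : ∀ x, g x ≤ C * wt x) (hgc : ∀ᵐ x, ContinuousAt g x) :
    ∀ c < 1 / entropy p * (∫ x, g x), ∀ᶠ t in atTop, c < renewalSum p g t := by
  intro c hc
  -- The envelope is taken of the bounded quotient, so that multiplying back by the weight gives
  -- minorants with a weighted modulus, dominated by `C wt`. The upper estimate is then applied to
  -- their negatives.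
  set φ : ℝ → ℝ := fun x => g x / wt x
  have hφ : ∀ x, wt x * φ x = g x := fun x => mul_div_cancel₀ _ (wt_pos x).ne'
  have hφ0 : ∀ x, 0 ≤ φ x := fun x => div_nonneg (hg0 x) (wt_pos x).le
  have hφC : ∀ x, φ x ≤ C := fun x => (div_le_iff₀ (wt_pos x)).2 (hg x)
  have henv : ∀ n x, |lowerEnvelope φ n x| ≤ C := fun n x => by
    rw [abs_of_nonneg (lowerEnvelope_nonneg hφ0 n x)]
    exact (lowerEnvelope_le hφ0 n x).trans (hφC x)
  have hgn : ∀ n x, |wt x * lowerEnvelope φ n x| ≤ C * wt x := fun n x => by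
    rw [abs_mul, abs_of_pos (wt_pos x), mul_comm]
    exact mul_le_mul_of_nonneg_right (henv n x) (wt_pos x).le
  have hmod := fun n => wt_mul_modulus (henv n) (abs_lowerEnvelope_sub_le hφ0 n)
  have hlim : Tendsto (fun n => ∫ x, wt x * lowerEnvelope φ n x) atTop (𝓝 (∫ x, g x)) := by
    refine tendsto_integral_of_dominated_convergence (fun x => C * wt x)
      (fun n => (continuous_of_wt_modulus (hmod n)).aestronglyMeasurable)
      (integrable_wt.const_mul C) (fun n => Eventually.of_forall (hgn n)) ?_
    filter_upwards [hgc] with x hx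
    rw [← hφ x]
    exact (tendsto_lowerEnvelope hφ0
      (hx.div continuous_wt.continuousAt (wt_pos x).ne')).const_mul _
  obtain ⟨n, hn⟩ := ((hlim.const_mul (1 / entropy p)).eventually (lt_mem_nhds hc)).exists
  have hev := eventually_renewalSum_lt hp0 hp1 hirr
    (g := fun x => -(wt x * lowerEnvelope φ n x)) (C := C)
    (fun x => by rw [abs_neg]; exact hgn n x)
    (fun ε hε => by
      obtain ⟨δ, hδ, h⟩ := hmod n ε hε
      refine ⟨δ, hδ, fun x y hxy => ?_⟩
      rw [← neg_sub', abs_neg]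
      exact h x y hxy) _ (sub_pos.2 hn)
  filter_upwards [hev] with t ht
  rw [renewalSum_neg, integral_neg] at ht
  have hle : renewalSum p (fun x => wt x * lowerEnvelope φ n x) t ≤ renewalSum p g t := by
    refine (summable_renewal hp0 hp1 (hgn n) t).tsum_le_tsum (fun α => ?_)
      (summable_renewal hp0 hp1 (fun x => by rw [abs_of_nonneg (hg0 x)]; exact hg x) t)
    refine mul_le_mul_of_nonneg_left ?_ (stringProb_pos hp0 hp1 α).le
    rw [← hφ]
    exact mul_le_mul_of_nonneg_left (lowerEnvelope_le hφ0 n _) (wt_pos _).le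
  linarith

/-- The renewal theorem in the non-arithmetic case. -/
lemma tendsto_renewalSum_nonarithmetic (hp0 : 0 < p) (hp1 : p < 1)
    (hirr : Irrational (Real.log p / Real.log (1 - p))) (hg0 : ∀ x, 0 ≤ g x)
    (hg : ∀ x, g x ≤ C * wt x) (hgc : ∀ᵐ x, ContinuousAt g x) :
    Tendsto (renewalSum p g) atTop (𝓝 (1 / entropy p * ∫ x, g x)) := by
  have hC : 0 ≤ C := by
    have := (hg0 0).trans (hg 0)
    rwa [wt_zero, mul_one] at this
  have hgabs : ∀ x, |g x| ≤ C * wt x := fun x => by rw [abs_of_nonneg (hg0 x)]; exact hg x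
  have hw : ∀ x, |wt x * C| ≤ C * wt x := fun x => by
    rw [mul_comm, abs_of_nonneg (mul_nonneg hC (wt_pos x).le)]
  have hint := integrable_of_le_wt (aestronglyMeasurable_of_ae_continuousAt hgc) hgabs
  rw [tendsto_order]
  refine ⟨eventually_lt_renewalSum hp0 hp1 hirr hg0 hg hgc, fun c hc => ?_⟩
  set ε := (c - 1 / entropy p * ∫ x, g x) / 2
  have hε : 0 < ε := half_pos (sub_pos.2 hc)
  have h1 := eventually_renewalSum_lt hp0 hp1 hirr hw
    (wt_mul_modulus (φ := fun _ => C) (n := 0) (C := C) (fun x => (abs_of_nonneg hC).le)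
      (fun x y => by simp)) ε hε
  -- A lower bound for `C wt - g`, combined with the upper bound for `C wt` itself, gives an upper
  -- bound for `g`.
  have h2 := eventually_lt_renewalSum hp0 hp1 hirr (g := fun x => wt x * C - g x) (C := C)
    (fun x => by linarith [hg x]) (fun x => by linarith [hg0 x])
    (hgc.mono fun x hx => (continuous_wt.continuousAt.mul continuousAt_const).sub hx)
    _ (sub_lt_self _ hε)
  rw [integral_sub (integrable_wt.mul_const C) hint] at h2
  filter_upwards [h1, h2] with t ht1 ht2
  have e : renewalSum p (fun x => wt x * C - g x) t
      = renewalSum p (fun x => wt x * C) t - renewalSum p g t := by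
    rw [renewalSum, renewalSum, renewalSum, ← Summable.tsum_sub
      (summable_renewal hp0 hp1 hw t) (summable_renewal hp0 hp1 hgabs t)]
    exact tsum_congr fun α => by rw [mul_sub]
  rw [e, mul_sub] at ht2
  have : c = 1 / entropy p * (∫ x, g x) + 2 * ε := by simp only [ε]; ring
  linarith

end NonArithmetic

/-! ### The substitution `x = e^{-t}` between `f` and `g` -/

lemma image_exp_neg_univ : (fun t : ℝ => Real.exp (-t)) '' univ = Ioi 0 := by
  ext x
  simp only [image_univ, mem_range, mem_Ioi]
  refine ⟨?_, fun hx => ⟨-Real.log x, by rw [neg_neg, Real.exp_log hx]⟩⟩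
  rintro ⟨t, rfl⟩
  exact Real.exp_pos _

lemma hasDerivAt_exp_neg (t : ℝ) :
    HasDerivAt (fun t : ℝ => Real.exp (-t)) (-Real.exp (-t)) t := by
  simpa using (hasDerivAt_neg t).exp

lemma injective_exp_neg : Function.Injective fun t : ℝ => Real.exp (-t) := fun _ _ h =>
  neg_injective (Real.exp_injective h)

lemma integral_Ioi_eq_integral_exp_neg {E : Type*} [NormedAddCommGroup E] [NormedSpace ℝ E]
    (F : ℝ → E) : ∫ x in Ioi (0 : ℝ), F x = ∫ t, Real.exp (-t) • F (Real.exp (-t)) := by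
  have := integral_image_eq_integral_abs_deriv_smul MeasurableSet.univ
    (fun t _ => (hasDerivAt_exp_neg t).hasDerivWithinAt) injective_exp_neg.injOn F
  simpa [image_exp_neg_univ, -image_univ] using this

lemma integrableOn_Ioi_iff_integrable_exp_neg {E : Type*} [NormedAddCommGroup E]
    [NormedSpace ℝ E] (F : ℝ → E) :
    IntegrableOn F (Ioi 0) ↔ Integrable fun t => Real.exp (-t) • F (Real.exp (-t)) := by
  have := integrableOn_image_iff_integrableOn_abs_deriv_smul MeasurableSet.univ
    (fun t _ => (hasDerivAt_exp_neg t).hasDerivWithinAt) injective_exp_neg.injOn F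
  simpa [image_exp_neg_univ, -image_univ] using this

section TestFunction

variable {f : ℝ → ℝ}

/-- The differentiable map `x ↦ -ln x` sends the null set of discontinuities in `(0, ∞)` to a null
set. -/
lemma ae_continuousAt_gFun (hf : ∀ᵐ x ∂(volume.restrict (Ioi (0 : ℝ))), ContinuousAt f x) :
    ∀ᵐ t, ContinuousAt (gFun f) t := by
  rw [ae_restrict_iff' measurableSet_Ioi, ae_iff] at hf
  have h0 := addHaar_image_eq_zero_of_differentiableOn_of_addHaar_eq_zero volume
    (f := fun x => -Real.log x) (fun x hx => by
      simp only [Classical.not_imp, mem_ofPred_eq, mem_Ioi] at hx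
      exact (Real.differentiableAt_log hx.1.ne').neg.differentiableWithinAt) hf
  refine ae_iff.2 (measure_mono_null (fun t ht => ?_) h0)
  refine ⟨Real.exp (-t), ?_, by simp⟩
  simp only [Classical.not_imp, mem_ofPred_eq, mem_Ioi]
  refine ⟨Real.exp_pos _, fun hc => ht ?_⟩
  exact Real.continuous_exp.continuousAt.mul
    (ContinuousAt.comp (f := fun t : ℝ => Real.exp (-t)) hc (by fun_prop))

lemma continuous_gFun (hf : ContinuousOn f (Ioi 0)) : Continuous (gFun f) :=
  Real.continuous_exp.mul (hf.comp_continuous (by fun_prop) fun t => Real.exp_pos (-t))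

lemma gFun_nonneg (hf : ∀ x, 0 < x → 0 ≤ f x) (t : ℝ) : 0 ≤ gFun f t :=
  mul_nonneg (Real.exp_pos _).le (hf _ (Real.exp_pos _))

lemma exists_gFun_le (h0 : ∃ C : ℝ, ∀ x, 0 < x → x < 1 → f x ≤ C * x ^ 2)
    (h1 : ∃ C : ℝ, ∀ x, 1 < x → f x ≤ C) : ∃ C : ℝ, ∀ t, gFun f t ≤ C * wt t := by
  obtain ⟨C₀, h0⟩ := h0
  obtain ⟨C₁, h1⟩ := h1
  -- The point `t = 0` corresponds to `x = 1`, which neither growth bound covers; hence the term `f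
  -- 1`.
  refine ⟨max (f 1) (max C₀ C₁), fun t => ?_⟩
  rcases lt_trichotomy t 0 with ht | rfl | ht
  · have h := h1 (Real.exp (-t)) (Real.one_lt_exp_iff.2 (by linarith))
    rw [gFun, wt, abs_of_neg ht, neg_neg, mul_comm]
    gcongr
    exact h.trans ((le_max_right _ _).trans (le_max_right _ _))
  · simp [gFun, wt]
  · have h := h0 (Real.exp (-t)) (Real.exp_pos _) (Real.exp_lt_one_iff.2 (by linarith))
    rw [gFun, wt, abs_of_pos ht]
    calc Real.exp t * f (Real.exp (-t)) ≤ Real.exp t * (C₀ * Real.exp (-t) ^ 2) := by gcongr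
      _ = C₀ * Real.exp (-t) * (Real.exp t * Real.exp (-t)) := by ring
      _ = C₀ * Real.exp (-t) := by rw [← Real.exp_add, add_neg_cancel, Real.exp_zero, mul_one]
      _ ≤ _ := by
        gcongr
        exact (le_max_left _ _).trans (le_max_right _ _)

lemma exp_neg_mul_div_sq (f : ℝ → ℝ) (t : ℝ) :
    Real.exp (-t) * (f (Real.exp (-t)) / Real.exp (-t) ^ 2) = gFun f t := by
  rw [gFun, Real.exp_neg]
  field_simp

lemma integrableOn_div_sq_iff : IntegrableOn (fun x : ℝ => f x / x ^ 2) (Ioi 0)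
    ↔ Integrable (gFun f) := by
  rw [integrableOn_Ioi_iff_integrable_exp_neg]
  simp only [smul_eq_mul, exp_neg_mul_div_sq]

lemma integral_gFun : ∫ t, gFun f t = ∫ x in Ioi (0 : ℝ), f x / x ^ 2 := by
  rw [integral_Ioi_eq_integral_exp_neg]
  simp only [smul_eq_mul, exp_neg_mul_div_sq]

lemma integral_exp_mul_gFun (c : ℂ) :
    ∫ t : ℝ, Complex.exp (c * t) * (gFun f t : ℂ)
      = ∫ x in Ioi (0 : ℝ), (f x : ℂ) * (x : ℂ) ^ (-2 - c) := by
  rw [integral_Ioi_eq_integral_exp_neg]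
  refine integral_congr_ae (Eventually.of_forall fun t => ?_)
  simp only
  have h1 : ((Real.exp (-t) : ℝ) : ℂ) ^ (-2 - c) = Complex.exp (2 * t) * Complex.exp (c * t) := by
    rw [Complex.cpow_def_of_ne_zero (by exact_mod_cast (Real.exp_pos _).ne'),
      ← Complex.ofReal_log (Real.exp_pos _).le, Real.log_exp, ← Complex.exp_add]
    congr 1
    push_cast
    ring
  rw [h1, gFun, Complex.real_smul]
  push_cast
  have h2 : Complex.exp t = Complex.exp (-t) * Complex.exp (2 * t) := by
    rw [← Complex.exp_add]
    congr 1
    ring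
  rw [h2]
  ring

lemma stringProb_mul_gFun {p : ℝ} (hp0 : 0 < p) (hp1 : p < 1) {l : ℝ} (hl : 0 < l)
    (α : List Bool) :
    stringProb p α * gFun f (-Real.log (stringProb p α) - Real.log l)
      = f (l * stringProb p α) / l := by
  have hP := stringProb_pos hp0 hp1 α
  have h1 : -Real.log (stringProb p α) - Real.log l = -Real.log (l * stringProb p α) := by
    rw [Real.log_mul hl.ne' hP.ne']
    ring
  rw [h1, gFun, neg_neg, Real.exp_neg, Real.exp_log (by positivity)]
  field_simp

lemma renewalSum_gFun {p : ℝ} (hp0 : 0 < p) (hp1 : p < 1) {l : ℝ} (hl : 0 < l) :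
    renewalSum p (gFun f) (Real.log l) = stringSum p f l / l := by
  rw [renewalSum, stringSum, ← tsum_div_const]
  exact tsum_congr fun α => stringProb_mul_gFun hp0 hp1 hl α

end TestFunction

/-! ### Fourier coefficients of the periodization -/

section Fourier

variable {d C : ℝ} {g : ℝ → ℝ}

lemma hasSum_integral_translates {F : ℝ → ℂ} (hd : 0 < d) (hF : Integrable F) :
    HasSum (fun k : ℤ => ∫ x in (0 : ℝ)..d, F (k * d - x)) (∫ x, F x) := by
  -- The tiles are `(kd - d, kd]` because `x ↦ kd - x` reflects the period onto them.
  have h := hasSum_integral_iUnion (f := F) (μ := volume)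
    (fun k : ℤ => measurableSet_Ioc (a := -d + k • d) (b := -d + (k + 1) • d))
    (pairwise_disjoint_Ioc_add_zsmul (-d) d) hF.integrableOn
  rw [iUnion_Ioc_add_zsmul hd, setIntegral_univ] at h
  refine h.congr_fun fun k => ?_
  rw [intervalIntegral.integral_comp_sub_left, intervalIntegral.integral_of_le (by linarith)]
  congr 3
  · simp only [zsmul_eq_mul]; ring
  · simp only [zsmul_eq_mul]; push_cast; ring

lemma aestronglyMeasurable_translate (hgm : AEStronglyMeasurable g) (c : ℝ) :
    AEStronglyMeasurable fun t => g (c - t) :=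
  hgm.comp_quasiMeasurePreserving
    (quasiMeasurePreserving_sub_left_of_right_invariant volume c)

lemma aestronglyMeasurable_tsum_translates (hd : 0 < d) (hg : ∀ x, |g x| ≤ C * wt x)
    (hgm : AEStronglyMeasurable g) :
    AEStronglyMeasurable fun t => ∑' k : ℤ, g (k * d - t) :=
  aestronglyMeasurable_of_tendsto_ae atTop
    (f := fun (s : Finset ℤ) t => ∑ k ∈ s, g (k * d - t))
    (fun s => Finset.aestronglyMeasurable_fun_sum s
      fun k _ => aestronglyMeasurable_translate hgm (k * d))
    (Eventually.of_forall fun t => (summable_int_translates hd hg t).hasSum)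

lemma intervalIntegrable_tsum_translates (hd : 0 < d) (hg : ∀ x, |g x| ≤ C * wt x)
    (hgm : AEStronglyMeasurable g) (a b : ℝ) :
    IntervalIntegrable (fun t => ∑' k : ℤ, g (k * d - t)) volume a b := by
  obtain ⟨B, hB⟩ := exists_abs_tsum_translates_le hd hg
  exact (intervalIntegrable_const (c := B)).mono_fun'
    (aestronglyMeasurable_tsum_translates hd hg hgm).restrict
    (Eventually.of_forall hB)

/-- Unfolding: `kd` disappears from the `d`-periodic exponential, so the terms are `F(kd - x)` and
their integrals over a period tile `∫ F`. The reflection turns `-m` into `m`. -/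
lemma integral_exp_mul_tsum_translates (hd : 0 < d) (hg : ∀ x, |g x| ≤ C * wt x)
    (hgm : AEStronglyMeasurable g) (m : ℤ) :
    ∫ x in (0 : ℝ)..d, Complex.exp (2 * Real.pi * Complex.I * (-m : ℤ) * x / d)
        * ((∑' k : ℤ, g (k * d - x) : ℝ) : ℂ)
      = ∫ t : ℝ, Complex.exp (2 * Real.pi * Complex.I * m * t / d) * (g t : ℂ) := by
  have hC : 0 ≤ C := nonneg_of_abs_le_wt hg
  have hd' : (d : ℂ) ≠ 0 := by exact_mod_cast hd.ne'
  set F : ℝ → ℂ := fun t => Complex.exp (2 * Real.pi * Complex.I * m * t / d) * (g t : ℂ) with hF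
  have hnorm : ∀ t, ‖F t‖ = |g t| := by
    intro t
    rw [hF, norm_mul, Complex.norm_real, Real.norm_eq_abs,
      show (2 * Real.pi * Complex.I * m * t / d : ℂ)
        = ((2 * Real.pi * m * t / d : ℝ) : ℂ) * Complex.I by push_cast; ring,
      Complex.norm_exp_ofReal_mul_I, one_mul]
  have hFm : AEStronglyMeasurable F :=
    (Continuous.aestronglyMeasurable (by fun_prop)).mul
      (Complex.continuous_ofReal.comp_aestronglyMeasurable hgm)
  have hFi : Integrable F :=
    (integrable_wt.const_mul C).mono' hFm (Eventually.of_forall fun t => by rw [hnorm]; exact hg t)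
  have hFk : ∀ (k : ℤ) (x : ℝ), F (k * d - x)
      = Complex.exp (2 * Real.pi * Complex.I * (-m : ℤ) * x / d) * (g (k * d - x) : ℂ) := by
    intro k x
    simp only [hF]
    congr 1
    rw [← mul_one (Complex.exp (_ * ((-m : ℤ) : ℂ) * _ / _)),
      ← Complex.exp_int_mul_two_pi_mul_I (m * k), ← Complex.exp_add]
    congr 1
    push_cast
    field_simp
    ring
  refine HasSum.unique ?_ (hasSum_integral_translates hd hFi)
  refine intervalIntegral.hasSum_integral_of_dominated_convergence
    (fun k _ => C * Real.exp d * wt (k * d))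
    (fun k => ?_) (fun k => Eventually.of_forall fun x hx => ?_)
    (Eventually.of_forall fun x _ => (summable_int_wt hd).mul_left _) intervalIntegrable_const
    (Eventually.of_forall fun x _ => ?_)
  · exact (hFm.comp_quasiMeasurePreserving
      (quasiMeasurePreserving_sub_left_of_right_invariant volume (k * d))).restrict
  · rw [uIoc_of_le hd.le] at hx
    rw [hnorm]
    refine (abs_le_exp_mul_wt hg (k * d) x).trans ?_
    have := wt_pos (k * d)
    rw [abs_of_pos hx.1]
    gcongr
    exact hx.2
  · exact ((Complex.hasSum_ofReal.2 (summable_int_translates hd hg x).hasSum).mul_left _).congr_fun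
      fun k => hFk k x

end Fourier

/-! ### The greatest common divisor of two commensurable numbers -/

/-- Commensurable negative numbers have a greatest common divisor, with coprime quotients. -/
lemma exists_isGreatest_commonDivisors {x y : ℝ} (hx : x < 0) (hy : y < 0)
    (hr : ∃ r : ℚ, x / y = r) :
    ∃ (d : ℝ) (i j : ℕ), 0 < d ∧ 0 < i ∧ 0 < j ∧ Nat.Coprime i j ∧ -x = i * d ∧ -y = j * d ∧
      IsGreatest (commonDivisors x y) d := by
  obtain ⟨r, hr⟩ := hr
  have hr0 : 0 < r := by
    have : (0 : ℝ) < r := hr ▸ div_pos_of_neg_of_neg hx hy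
    exact_mod_cast this
  obtain ⟨i, hi⟩ := Int.eq_ofNat_of_zero_le (Rat.num_nonneg.2 hr0.le)
  have hi0 : 0 < i := by
    have := Rat.num_pos.2 hr0
    omega
  have hj0 : 0 < r.den := r.den_pos
  have hij : Nat.Coprime i r.den := by
    have := r.reduced
    rwa [hi, Int.natAbs_natCast] at this
  have hj0' : (0 : ℝ) < r.den := by exact_mod_cast hj0
  have hxy : x * r.den = i * y := by
    have h1 : (r : ℝ) = i / r.den := by
      rw [Rat.cast_def, hi, Int.cast_natCast]
    rw [h1, div_eq_div_iff hy.ne hj0'.ne'] at hr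
    exact hr
  set j := r.den
  -- With `x/y = i/j` in lowest terms, the greatest common divisor is `-y/j`.
  have hdy : -y = j * (-y / j) := by field_simp
  have hdx : -x = i * (-y / j) := by
    field_simp
    linarith
  have hd : 0 < -y / j := div_pos (by linarith) hj0'
  refine ⟨-y / j, i, j, hd, hi0, hj0, hij, hdx, hdy,
    ⟨hd, ⟨-i, ?_⟩, ⟨-j, ?_⟩⟩, ?_⟩
  · push_cast; linarith
  · push_cast; linarith
  · rintro δ ⟨hδ, ⟨m, hm⟩, n, hn⟩
    have h1 : (m * j : ℤ) = i * n := by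
      have : (m * j : ℝ) = i * n := by
        rw [hm, hn] at hxy
        have : (m * j : ℝ) * δ = i * n * δ := by linarith
        exact mul_right_cancel₀ hδ.ne' this
      exact_mod_cast this
    -- From `mj = in` and coprimality, `j` divides `n`; since `n < 0`, this gives `-n ≥ j`, hence `δ
    -- = -y/(-n) ≤ -y/j`.
    have h2 : (j : ℤ) ∣ n :=
      (Int.isCoprime_iff_gcd_eq_one.2 (by simpa [Int.gcd_natCast_natCast] using hij.symm)
        : IsCoprime (j : ℤ) (i : ℤ)).dvd_of_dvd_mul_left ⟨m, by rw [← h1]; ring⟩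
    have hn0 : (n : ℝ) < 0 := by
      rw [hn] at hy
      exact neg_of_mul_neg_left hy hδ.le
    have hn0' : n < 0 := by exact_mod_cast hn0
    have h3 : (j : ℤ) ≤ -n := Int.le_of_dvd (by omega) (Int.dvd_neg.2 h2)
    have h4 : (j : ℝ) ≤ -n := by exact_mod_cast h3
    rw [le_div_iff₀ hj0', hn]
    nlinarith

lemma hasFourierSeries_tsum_translates {d C : ℝ} {g : ℝ → ℝ} (hd : 0 < d)
    (hg : ∀ x, |g x| ≤ C * wt x) (hgm : AEStronglyMeasurable g) :
    HasFourierSeries d (fun t => d * ∑' k : ℤ, g (k * d - t))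
      (fun m : ℤ => ∫ t : ℝ, Complex.exp (2 * Real.pi * Complex.I * m * t / d) * (g t : ℂ)) := by
  have hd' : (d : ℂ) ≠ 0 := by exact_mod_cast hd.ne'
  refine ⟨(intervalIntegrable_tsum_translates hd hg hgm 0 d).const_mul d, hd, fun m => ?_⟩
  simp only [fourierCoeffOn_eq_integral, ← integral_exp_mul_tsum_translates hd hg hgm m]
  have h : ∀ x : ℝ, fourier (-m) (x : AddCircle (d - 0))
        • (((d * ∑' k : ℤ, g (k * d - x) : ℝ)) : ℂ)
      = (d : ℂ) * (Complex.exp (2 * Real.pi * Complex.I * (-m : ℤ) * x / d)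
        * ((∑' k : ℤ, g (k * d - x) : ℝ) : ℂ)) := by
    intro x
    rw [fourier_coe_apply, smul_eq_mul, Complex.ofReal_mul, sub_zero]
    ring
  simp only [h]
  rw [intervalIntegral.integral_const_mul, Complex.real_smul, ← mul_assoc]
  push_cast
  rw [sub_zero, one_div, inv_mul_cancel₀ hd', one_mul]

lemma fourierHat_neg_eq (g : ℝ → ℝ) (d : ℝ) (m : ℤ) :
    fourierHat g (-(2 * Real.pi * m / d))
      = ∫ t : ℝ, Complex.exp (2 * Real.pi * Complex.I * m * t / d) * (g t : ℂ) := by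
  rw [fourierHat]
  congr 1
  funext t
  congr 2
  push_cast
  ring

end TrieRenewal

/-! ### Proof of the theorem -/

open TrieRenewal
theorem mainTheorem1 (p : ℝ) (hp0 : 0 < p) (hp1 : p < 1) (f : ℝ → ℝ)
    (hf_nonneg : ∀ x, 0 < x → 0 ≤ f x)
    (hf_cont : ∀ᵐ x ∂(volume.restrict (Ioi (0 : ℝ))), ContinuousAt f x)
    (hf_zero : ∃ C : ℝ, ∀ x, 0 < x → x < 1 → f x ≤ C * x ^ 2)
    (hf_infty : ∃ C : ℝ, ∀ x, 1 < x → f x ≤ C) :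
    -- the sum and the integrals below converge
    (∀ l : ℝ, 0 < l → Summable fun α : List Bool => f (l * stringProb p α)) ∧
    Integrable (gFun f) ∧
    IntegrableOn (fun x : ℝ => f x / x ^ 2) (Ioi 0) ∧
    -- the non-arithmetic case
    (Irrational (Real.log p / Real.log (1 - p)) →
      Tendsto (fun l : ℝ => stringSum p f l / l) atTop
        (𝓝 (1 / entropy p * ∫ t : ℝ, gFun f t)) ∧
      1 / entropy p * ∫ t : ℝ, gFun f t = 1 / entropy p * ∫ x in Ioi (0 : ℝ), f x / x ^ 2) ∧
    -- the arithmetic case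
    ((∃ r : ℚ, Real.log p / Real.log (1 - p) = r) →
      IsGreatest (commonDivisors (Real.log p) (Real.log (1 - p))) (span p) ∧
      ∃ ψ : ℝ → ℝ,
        (fun l : ℝ => stringSum p f l / l - 1 / entropy p * ψ (Real.log l))
          =o[atTop] (fun _ : ℝ => (1 : ℝ)) ∧
        (∃ B : ℝ, ∀ t, |ψ t| ≤ B) ∧
        Function.Periodic ψ (span p) ∧
        HasFourierSeries (span p) ψ
          (fun m : ℤ => fourierHat (gFun f) (-(2 * Real.pi * m / span p))) ∧
        (∀ m : ℤ,
          fourierHat (gFun f) (-(2 * Real.pi * m / span p)) =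
              ∫ t : ℝ, Complex.exp (2 * Real.pi * Complex.I * m * t / span p) * (gFun f t : ℂ) ∧
          ∫ t : ℝ, Complex.exp (2 * Real.pi * Complex.I * m * t / span p) * (gFun f t : ℂ) =
              ∫ x in Ioi (0 : ℝ),
                (f x : ℂ) * (x : ℂ) ^ (-2 - 2 * Real.pi * Complex.I * m / span p : ℂ)) ∧
        (∀ t : ℝ, (Summable fun k : ℤ => gFun f (k * span p - t)) ∧
          ψ t = span p * ∑' k : ℤ, gFun f (k * span p - t)) ∧
        (ContinuousOn f (Ioi 0) → Continuous ψ)) := by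
  obtain ⟨C, hgC⟩ := exists_gFun_le hf_zero hf_infty
  have hg0 := gFun_nonneg hf_nonneg
  have hg : ∀ x, |gFun f x| ≤ C * wt x := fun x => by rw [abs_of_nonneg (hg0 x)]; exact hgC x
  have hgc := ae_continuousAt_gFun hf_cont
  have hgm := aestronglyMeasurable_of_ae_continuousAt hgc
  have hgi := integrable_of_le_wt hgm hg
  have hq : 0 < 1 - p := by linarith
  refine ⟨fun l hl => ?_, hgi, integrableOn_div_sq_iff.2 hgi, fun hirr => ⟨?_, ?_⟩, fun hr => ?_⟩
  · have h := (summable_renewal hp0 hp1 hg (Real.log l)).mul_left l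
    refine h.congr fun α => ?_
    rw [stringProb_mul_gFun hp0 hp1 hl, mul_div_cancel₀ _ hl.ne']
  · refine ((tendsto_renewalSum_nonarithmetic hp0 hp1 hirr hg0 hgC hgc).comp
      Real.tendsto_log_atTop).congr' ?_
    filter_upwards [eventually_gt_atTop 0] with l hl
    exact renewalSum_gFun hp0 hp1 hl
  · rw [integral_gFun]
  · obtain ⟨d, i, j, hd, hi0, hj0, hij, hi, hj, hgr⟩ := exists_isGreatest_commonDivisors
      (Real.log_neg hp0 hp1) (Real.log_neg hq (by linarith)) hr
    -- The supremum defining the span is attained, so no default value intervenes.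
    have hspan : TrieRenewal.span p = d := hgr.csSup_eq
    rw [hspan]
    obtain ⟨B, hB⟩ := exists_abs_tsum_translates_le hd hg
    refine ⟨hgr, fun t => d * ∑' k : ℤ, gFun f (k * d - t), ?_, ⟨d * B, fun t => ?_⟩, ?_, ?_,
      fun m => ⟨fourierHat_neg_eq _ _ _, ?_⟩,
      fun t => ⟨summable_int_translates hd hg t, rfl⟩, fun hfc => ?_⟩
    · rw [Asymptotics.isLittleO_one_iff]
      refine ((tendsto_renewalSum_arithmetic hp0 hp1 hg hd hi0 hj0 hij hi hj).comp
        Real.tendsto_log_atTop).congr' ?_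
      filter_upwards [eventually_gt_atTop 0] with l hl
      rw [← renewalSum_gFun hp0 hp1 hl]
      rfl
    · rw [abs_mul, abs_of_pos hd]
      exact mul_le_mul_of_nonneg_left (hB t) hd.le
    · exact fun t => congrArg (d * ·) (periodic_tsum_translates (gFun f) d t)
    · simp only [fourierHat_neg_eq]
      exact hasFourierSeries_tsum_translates hd hg hgm
    · have h := integral_exp_mul_gFun (f := f) (2 * Real.pi * Complex.I * m / d)
      rw [← h]
      congr 1
      funext t
      congr 2
      ring
    · exact (continuous_tsum_translates hd hg (continuous_gFun hfc)).const_mul d
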